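/- Let $n,p\ge 0$ be integers. On $\mathbb R^n\times\mathbb R^n$, with coordinates $(x,\xi)$, consider forms $\alpha=\sum_{K,L}\alpha_{KL}(x)\,dx_K\wedge d\xi_L$ whose coefficients depend on $x$ only ($K,L$ increasing multi-indices), let $d\alpha=\sum_{K,L,i}\frac{\partial\alpha_{KL}}{\partial x_i}\,dx_i\wedge dx_K\wedge d\xi_L$, let $J$ be the algebra map that exchanges $dx_i$ and $d\xi_i$, and let $d^{\#}=J\circ d\circ J$; thus $dd^{\#}f=\sum_{i,j}\frac{\partial^2 f}{\partial x_i\partial x_j}\,dx_i\wedge d\xi_j$ for smooth $f$. Let $M_p$ be the space of $(p,p)$-forms $T=\sum_{|K|=|L|=p}T_{KL}\,dx_K\wedge d\xi_L$ whose coefficients $T_{KL}$ are (locally finite, signed) measures on $\mathbb R^n$, with the weak topology in which $T_i\to T$ if and only if $T_i(\alpha)\to T(\alpha)$ for every compactly supported $(n-p,n-p)$-form $\alpha$ with continuous coefficients, where $T(\alpha)=\sum_{|K|=|L|=p}\pm\int\alpha_{K^cL^c}\,dT_{KL}$ and the sign is the one for which $dx_K\wedge d\xi_L\wedge dx_{K^c}\wedge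 d\xi_{L^c}=\pm\, dx_1\wedge d\xi_1\wedge\dots\wedge dx_n\wedge d\xi_n$. A smooth $(p,p)$-form is regarded as the element of $M_p$ whose coefficients are the measures $\alpha_{KL}(x)\,dx$. Let $f_1,\dots,f_p:\mathbb R^n\to\mathbb R$ be convex functions. Call sequences $(f_1^k)_k,\dots,(f_p^k)_k$ of smooth convex functions on $\mathbb R^n$ approximating if, for each $i$, $f_i^k\to f_i$ uniformly on compact subsets as $k\to\infty$. Then: 1. For all approximating sequences, the sequence $\{dd^{\#}f_1^k\wedge\dots\wedge dd^{\#}f_p^k\}_k$ contains a subsequence that converges in $M_p$. 2. If $(f_i^k)_k$ and $(g_i^k)_k$ are approximating sequences (for the same $f_1,\dots,f_p$) and the limits in $M_p$ of $dd^{\#}f_1^k\wedge\dots\wedge dd^{\#}f_p^k$ and of $dd^{\#}g_1^k\wedge\dots\wedge dd^{\#}g_p^k$ exist, then these limits are equal. 3. Consequently the intersection product $dd^{\#}f_1\wedge\dots\wedge dd^{\#}f_p$ is well defined: there is exactly one $T\in M_p$ that is the limit in $M_p$ of a subsequence of $dd^{\#}f_1^k\wedge\dots\wedge dd^{\#}f_p^k$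 for some approximating sequences $(f_i^k)_k$. -/

import Mathlib

open MeasureTheory Filter Topology
open scoped ContDiff CompactlySupported

noncomputable section

namespace SuperCurrent

/-! ### Super forms on `𝔼 = 𝕍 × 𝕎`, `𝕍 = ℝⁿ` -/

/-- The space `𝕍 = ℝⁿ` with its Euclidean structure. -/
abbrev V (n : ℕ) := EuclideanSpace ℝ (Fin n)

/-- Constant covectors on `𝔼 = 𝕍 × 𝕎`, written in the basis
`dx₁, …, dxₙ, dξ₁, …, dξₙ` (`inlₗ i` is the index of `dxᵢ`, `inrₗ i` that of `dξᵢ`). -/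
abbrev Covector (n : ℕ) := Fin n ⊕ₗ Fin n → ℝ

/-- Differential forms with constant coefficients on `𝔼`; the product is the wedge product. -/
abbrev ConstForm (n : ℕ) := ExteriorAlgebra ℝ (Covector n)

/-- The constant form `dxᵢ`. -/
def dx {n : ℕ} (i : Fin n) : ConstForm n :=
  ExteriorAlgebra.ι ℝ (Pi.single (Sum.inlₗ i) 1)

/-- The basis of the space of constant forms that consists of the increasing wedge products of
`dx₁, …, dxₙ, dξ₁, …, dξₙ` (in this order). -/
def formBasis (n : ℕ) : Module.Basis (Finset (Fin n ⊕ₗ Fin n)) ℝ (ConstForm n) :=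
  (Pi.basisFun ℝ (Fin n ⊕ₗ Fin n)).ExteriorAlgebra

/-- The index of the basis element `dx_K ∧ dξ_L`. -/
def superIndex {n : ℕ} (K L : Finset (Fin n)) : Finset (Fin n ⊕ₗ Fin n) :=
  (K.disjSum L).map toLex.toEmbedding

/-- The constant form `dx_K ∧ dξ_L`, both index sets in increasing order. -/
def monomial {n : ℕ} (K L : Finset (Fin n)) : ConstForm n :=
  formBasis n (superIndex K L)

/-- The coefficient `α_{KL}` of `dx_K ∧ dξ_L` in a constant form `α`. -/
def coeff {n : ℕ} (K L : Finset (Fin n)) : ConstForm n →ₗ[ℝ] ℝ :=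
  (formBasis n).coord (superIndex K L)

/-- A form on `𝔼` whose coefficients are functions of `x` only. -/
abbrev SuperForm (n : ℕ) := V n → ConstForm n

/-- `α` is a finite sum of constant forms multiplied by smooth functions of `x`. -/
def IsSmooth {n : ℕ} (α : SuperForm n) : Prop :=
  ∃ (ι : Type) (_ : Fintype ι) (c : ι → V n → ℝ) (a : ι → ConstForm n),
    (∀ j, ContDiff ℝ ∞ (c j)) ∧ ∀ x, α x = ∑ j, c j x • a j

/-- The involution `J` on constant forms, `J(dxᵢ) = dξᵢ` and `J(dξᵢ) = dxᵢ`, extended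
multiplicatively. -/
def J {n : ℕ} : ConstForm n →ₐ[ℝ] ConstForm n :=
  ExteriorAlgebra.map (LinearMap.funLeft ℝ ℝ fun i => toLex (ofLex i).swap)

/-- `d (∑ α_{KL} dx_K ∧ dξ_L) = ∑ (∂α_{KL} / ∂xᵢ) dxᵢ ∧ dx_K ∧ dξ_L`. -/
def d {n : ℕ} (α : SuperForm n) : SuperForm n := fun x =>
  ∑ K : Finset (Fin n), ∑ L : Finset (Fin n), ∑ i : Fin n,
    fderiv ℝ (fun y => coeff K L (α y)) x (EuclideanSpace.single i 1) • (dx i * monomial K L)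

/-- `d^# = J ∘ d ∘ J`. -/
def dSharp {n : ℕ} (α : SuperForm n) : SuperForm n := fun x => J (d (fun y => J (α y)) x)

/-- `dd^# f` for a function `f`, regarded as a form of bidegree `(0, 0)`. -/
def ddSharp {n : ℕ} (f : V n → ℝ) : SuperForm n :=
  d (dSharp fun x => algebraMap ℝ (ConstForm n) (f x))

/-- `dd^# f₁ ∧ … ∧ dd^# f_p`. -/
def wedgeDDSharp {n p : ℕ} (f : Fin p → V n → ℝ) : SuperForm n := fun x =>
  (List.ofFn fun i => ddSharp (f i) x).prod

theorem IsSmooth.contDiff {n : ℕ} {α : SuperForm n} (h : IsSmooth α)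
    (l : ConstForm n →ₗ[ℝ] ℝ) : ContDiff ℝ ∞ fun x => l (α x) := by
  obtain ⟨ι, _, c, a, hc, h⟩ := h
  simp only [h, map_sum, map_smul, smul_eq_mul]
  exact ContDiff.sum fun j _ => (hc j).mul contDiff_const

theorem IsSmooth.map {n : ℕ} {α : SuperForm n} (h : IsSmooth α)
    (l : ConstForm n →ₗ[ℝ] ConstForm n) : IsSmooth fun x => l (α x) := by
  obtain ⟨ι, _, c, a, hc, h⟩ := h
  exact ⟨ι, inferInstance, c, fun j => l (a j), hc, fun x => by simp [h]⟩

theorem IsSmooth.mul {n : ℕ} {α β : SuperForm n} (hα : IsSmooth α) (hβ : IsSmooth β) :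
    IsSmooth fun x => α x * β x := by
  obtain ⟨ι, _, c, a, hc, hα⟩ := hα
  obtain ⟨κ, _, e, b, he, hβ⟩ := hβ
  refine ⟨ι × κ, inferInstance, fun j x => c j.1 x * e j.2 x, fun j => a j.1 * b j.2,
    fun j => (hc _).mul (he _), fun x => ?_⟩
  simp only [hα, hβ, Finset.sum_mul_sum, Fintype.sum_prod_type, smul_mul_smul_comm]

theorem IsSmooth.of_fun {n : ℕ} {f : V n → ℝ} (hf : ContDiff ℝ ∞ f) :
    IsSmooth fun x => algebraMap ℝ (ConstForm n) (f x) :=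
  ⟨Unit, inferInstance, fun _ => f, fun _ => 1, fun _ => hf,
    fun x => by simp [Algebra.algebraMap_eq_smul_one]⟩

theorem IsSmooth.d {n : ℕ} {α : SuperForm n} (h : IsSmooth α) : IsSmooth (d α) := by
  refine ⟨Finset (Fin n) × Finset (Fin n) × Fin n, inferInstance,
    fun j x => fderiv ℝ (fun y => coeff j.1 j.2.1 (α y)) x (EuclideanSpace.single j.2.2 1),
    fun j => dx j.2.2 * monomial j.1 j.2.1, fun j => ?_, fun x => ?_⟩
  · exact ((h.contDiff (coeff j.1 j.2.1)).fderiv_right (m := ∞) le_rfl).clm_apply contDiff_const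
  · simp only [Fintype.sum_prod_type, SuperCurrent.d]

theorem IsSmooth.ddSharp {n : ℕ} {f : V n → ℝ} (hf : ContDiff ℝ ∞ f) : IsSmooth (ddSharp f) :=
  ((((IsSmooth.of_fun hf).map J.toLinearMap).d).map J.toLinearMap).d

theorem IsSmooth.wedgeDDSharp {n p : ℕ} {f : Fin p → V n → ℝ} (hf : ∀ i, ContDiff ℝ ∞ (f i)) :
    IsSmooth (wedgeDDSharp f) := by
  induction p with
  | zero =>
    have h : IsSmooth fun _ : V n => algebraMap ℝ (ConstForm n) 1 := IsSmooth.of_fun contDiff_const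
    change IsSmooth fun x => (List.ofFn fun i => SuperCurrent.ddSharp (f i) x).prod
    simpa using h
  | succ p ih =>
    have h := (IsSmooth.ddSharp (hf 0)).mul (ih fun i => hf i.succ)
    change IsSmooth fun x => (List.ofFn fun i => SuperCurrent.ddSharp (f i) x).prod
    simp only [List.ofFn_succ, List.prod_cons]
    exact h

/-! ### Currents with measure coefficients -/

/-- A signed (Radon) measure on `ℝⁿ`, not necessarily of finite total variation, regarded as the
functional that it induces on continuous functions of compact support: a difference of two
locally finite Borel measures. -/
@[ext]
structure SignedRadonMeasure (n : ℕ) where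
  toFun : C_c(V n, ℝ) →ₗ[ℝ] ℝ
  exists_measure : ∃ μ ν : Measure (V n), IsLocallyFiniteMeasure μ ∧ IsLocallyFiniteMeasure ν ∧
    ∀ φ : C_c(V n, ℝ), toFun φ = ∫ x, φ x ∂μ - ∫ x, φ x ∂ν

theorem integrable_mul {n : ℕ} {g : V n → ℝ} (hg : Continuous g) (φ : C_c(V n, ℝ)) :
    Integrable fun x => φ x * g x :=
  (φ.continuous.mul hg).integrable_of_hasCompactSupport φ.hasCompactSupport.mul_right

/-- The signed measure `g(x) dx` with a continuous density `g`. -/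
def SignedRadonMeasure.ofDensity {n : ℕ} (g : V n → ℝ) (hg : Continuous g) :
    SignedRadonMeasure n where
  toFun :=
    { toFun := fun φ => ∫ x, φ x * g x
      map_add' := fun φ ψ => by
        simp only [CompactlySupportedContinuousMap.coe_add, Pi.add_apply, add_mul]
        exact integral_add (integrable_mul hg φ) (integrable_mul hg ψ)
      map_smul' := fun c φ => by
        simp only [CompactlySupportedContinuousMap.coe_smul, Pi.smul_apply, smul_eq_mul,
          mul_assoc, RingHom.id_apply]
        exact integral_const_mul _ _ }
  exists_measure := by
    refine ⟨volume.withDensity fun x => ENNReal.ofReal (g x),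
      volume.withDensity fun x => ENNReal.ofReal (-g x),
      IsLocallyFiniteMeasure.withDensity_ofReal hg,
      IsLocallyFiniteMeasure.withDensity_ofReal hg.neg, fun φ => ?_⟩
    rw [integral_withDensity_eq_integral_toReal_smul (by fun_prop) (by simp),
      integral_withDensity_eq_integral_toReal_smul (by fun_prop) (by simp), ← integral_sub]
    · refine integral_congr_ae (Eventually.of_forall fun x => ?_)
      simp only [smul_eq_mul, ENNReal.toReal_ofReal']
      rcases le_total 0 (g x) with h | h
      · simp [h, mul_comm]
      · simp [h, mul_comm]
    · simp only [smul_eq_mul, ENNReal.toReal_ofReal', mul_comm _ (φ _)]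
      exact integrable_mul (by fun_prop) φ
    · simp only [smul_eq_mul, ENNReal.toReal_ofReal', mul_comm _ (φ _)]
      exact integrable_mul (by fun_prop) φ

/-- Increasing multi-indices of length `p`. -/
abbrev MultiIndex (n p : ℕ) := {K : Finset (Fin n) // K.card = p}

/-- The complementary multi-index. -/
def MultiIndex.compl {n p : ℕ} (K : MultiIndex n p) : MultiIndex n (n - p) :=
  ⟨K.1ᶜ, by rw [Finset.card_compl, K.2, Fintype.card_fin]⟩

/-- The space `M_p` of `(p, p)`-forms `∑ T_{KL} dx_K ∧ dξ_L` on `𝔼` whose coefficients are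
measures on `𝕍`. -/
@[ext]
structure MeasureCurrent (n p : ℕ) where
  coeff : MultiIndex n p → MultiIndex n p → SignedRadonMeasure n

/-- A `(q, q)`-form whose coefficients are continuous functions with compact support on `𝕍`. -/
abbrev TestForm (n q : ℕ) := MultiIndex n q → MultiIndex n q → C_c(V n, ℝ)

/-- The number `g` such that the `(n, n)`-component of `v` is `g ωₙ`, where
`ωₙ = dx₁ ∧ dξ₁ ∧ … ∧ dxₙ ∧ dξₙ = (-1)^{n(n-1)/2} dx₁ ∧ … ∧ dxₙ ∧ dξ₁ ∧ … ∧ dξₙ`. -/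
def topCoeff {n : ℕ} (v : ConstForm n) : ℝ :=
  (-1) ^ (n * (n - 1) / 2) * coeff Finset.univ Finset.univ v

/-- The sign for which `dx_K ∧ dξ_L ∧ dx_{Kᶜ} ∧ dξ_{Lᶜ} = ± ωₙ`. -/
def pairingSign {n : ℕ} (K L : Finset (Fin n)) : ℝ :=
  topCoeff (monomial K L * monomial Kᶜ Lᶜ)

/-- `T(α) = ⟨T, α⟩` for a test form `α` of bidegree `(n - p, n - p)`. -/
def MeasureCurrent.pairing {n p : ℕ} (T : MeasureCurrent n p) (α : TestForm n (n - p)) : ℝ :=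
  ∑ K : MultiIndex n p, ∑ L : MultiIndex n p,
    pairingSign K.1 L.1 * (T.coeff K L).toFun (α K.compl L.compl)

/-- The topology of `M_p`: `T_i → T` iff `T_i(α) → T(α)` for every compactly supported
`(n - p, n - p)`-form `α` with continuous coefficients. -/
instance (n p : ℕ) : TopologicalSpace (MeasureCurrent n p) :=
  TopologicalSpace.induced MeasureCurrent.pairing inferInstance

theorem MeasureCurrent.tendsto_iff {n p : ℕ} {ι : Type*} {l : Filter ι}
    {S : ι → MeasureCurrent n p} {T : MeasureCurrent n p} :
    Tendsto S l (𝓝 T) ↔ ∀ α, Tendsto (fun k => (S k).pairing α) l (𝓝 (T.pairing α)) := by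
  rw [nhds_induced, tendsto_comap_iff, tendsto_pi_nhds]
  rfl

/-- The current in `M_p` given by the `(p, p)`-component of a smooth form. -/
def IsSmooth.toCurrent {n : ℕ} {α : SuperForm n} (h : IsSmooth α) (p : ℕ) :
    MeasureCurrent n p where
  coeff K L := .ofDensity (fun x => SuperCurrent.coeff K.1 L.1 (α x)) (h.contDiff _).continuous

/-! ### The map `Ψ_p` and the intersection product -/

/-- The set `K` of smooth convex functions on `𝕍`. -/
abbrev SmoothConvex (n : ℕ) := {f : V n → ℝ // ContDiff ℝ ∞ f ∧ ConvexOn ℝ Set.univ f}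

/-- `Ψ_p(f₁, …, f_p) = dd^# f₁ ∧ … ∧ dd^# f_p`, a map from `K^p` to `M_p`. -/
def Psi {n p : ℕ} (f : Fin p → SmoothConvex n) : MeasureCurrent n p :=
  (IsSmooth.wedgeDDSharp fun i => (f i).2.1).toCurrent p

/-- For each `i`, the sequence `(F k i)_k` of smooth convex functions converges to `f i` uniformly
on compact sets. -/
def Approximates {n p : ℕ} (F : ℕ → Fin p → SmoothConvex n) (f : Fin p → V n → ℝ) : Prop :=
  ∀ i, ∀ C : Set (V n), IsCompact C → TendstoUniformlyOn (fun k => (F k i).1) (f i) atTop C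

/-- `T` is a value of the intersection product `dd^# f₁ ∧ … ∧ dd^# f_p`: it is the limit in `M_p`
of a subsequence of `dd^# f₁^k ∧ … ∧ dd^# f_p^k` for some smooth convex `f_i^k → f_i`. -/
def IsIntersectionProduct {n p : ℕ} (f : Fin p → V n → ℝ) (T : MeasureCurrent n p) : Prop :=
  ∃ F : ℕ → Fin p → SmoothConvex n, Approximates F f ∧
    ∃ φ : ℕ → ℕ, StrictMono φ ∧ Tendsto (fun k => Psi (F (φ k))) atTop (𝓝 T)

end SuperCurrent

end

/-!
The limit exists for every approximating sequence, without passing to subsequences, and depends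
only on the limit functions `f₁, …, f_p`.

The coefficients of `dd^# f₁ ∧ … ∧ dd^# f_p` are mixed minors of the Hessians of the `fᵢ`
(`exists_coeff_wedgeDDSharp`): contractions `M(U, W)` of `Hess f₁ ⊗ … ⊗ Hess f_p` with two
alternating forms `U` and `W`, one for the row indices and one for the column indices (`mixed`).
Two facts about them carry the proof.

* Positivity. Writing positive semidefinite matrices as `Bᵀ B` gives
  `M(U, W) = ∑ U(b) W(b)`, a sum over choices of one row of each `B` (`mixed_gram`). Hence
  `M(U, U) ≥ 0` and `2 |M(U, W)| ≤ M(U, U) + M(W, W)`.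
* Integration by parts. As `U` and `W` are alternating and partial derivatives commute, both
  derivatives of `f₁` can be moved to a test function `φ`:
  `∫ φ M(U, W)(f₁, …, f_p) = ∑ ∫ f₁ (∂ⱼ ∂ᵢ φ) M(Uᵢ, Wⱼ)(f₂, …, f_p)`, where `Uᵢ` and `Wⱼ` are
  contractions with basis vectors (`integral_mul_mixedDensity`).

By induction on `p`, the second fact bounds `∫ φ M(U, U)` for a cutoff function `φ` as long as the
`fᵢ` stay locally bounded, and the first extends the bound to all coefficients
(`exists_eventually_integral_abs_density_le`). A second induction then shows that `∫ φ M(U, W)`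
converges: `f₁` converges uniformly on the support of `φ`, the remaining factor converges weakly
with bounded mass, and the mass bound passes from smooth to continuous `φ`
(`exists_tendsto_integral_mul_density`). The limit functional is a difference of two positive
functionals by the first fact, hence a signed measure by the Riesz–Markov–Kakutani theorem
(`exists_limit_measure`).

Convergence is proved for families along any filter. For two approximating sequences, applied
to their disjoint union, it shows that the limits agree (`limit_unique`). Approximating sequences
exist by mollification, and limits in `M_p` are unique because test forms separate currents.
-/

noncomputable section

namespace SuperCurrent

/-! ### Mixed minors of symmetric matrices -/

/-- Alternating `p`-forms on `ℝⁿ`. -/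
abbrev AltForm (n p : ℕ) := (Fin n → ℝ) [⋀^Fin p]→ₗ[ℝ] ℝ

/-- The value of an alternating form on the basis vectors with the indices `a`. -/
def AltForm.comp {n p : ℕ} (U : AltForm n p) (a : Fin p → Fin n) : ℝ :=
  U fun i => Pi.single (a i) 1

/-- The contraction of an alternating form with the `i`-th basis vector. -/
def AltForm.contract {n p : ℕ} (U : AltForm n (p + 1)) (i : Fin n) : AltForm n p :=
  U.curryLeft (Pi.single i 1)

/-- The contraction of `H₁ ⊗ … ⊗ H_p` with `U` in the row indices and with `W` in the column
indices. If `U` and `W` are the minors on the index sets `K` and `L`, this is the mixed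
(polarized) minor of `H₁, …, H_p` with rows `K` and columns `L`. -/
def mixed {n p : ℕ} (U W : AltForm n p) (H : Fin p → Matrix (Fin n) (Fin n) ℝ) : ℝ :=
  ∑ a : Fin p → Fin n, ∑ b : Fin p → Fin n, U.comp a * W.comp b * ∏ i, H i (a i) (b i)

theorem AltForm.comp_cons {n p : ℕ} (U : AltForm n (p + 1)) (i : Fin n) (a : Fin p → Fin n) :
    U.comp (Fin.cons i a : Fin (p + 1) → Fin n) = (U.contract i).comp a := by
  simp only [comp, contract, AlternatingMap.curryLeft_apply_apply]
  congr 1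
  ext k
  refine Fin.cases ?_ (fun k => ?_) k <;> simp [Matrix.vecCons]

theorem AltForm.comp_swap {n p : ℕ} (U : AltForm n p) (a : Fin p → Fin n) {i j : Fin p}
    (h : i ≠ j) : U.comp (a ∘ Equiv.swap i j) = -U.comp a :=
  U.map_swap (fun k => Pi.single (a k) 1) h

theorem AltForm.apply_eq_sum {n p : ℕ} (U : AltForm n p) (v : Fin p → Fin n → ℝ) :
    U v = ∑ a : Fin p → Fin n, (∏ i, v i (a i)) * U.comp a := by
  have h : v = fun i => ∑ j, v i j • (Pi.single j 1 : Fin n → ℝ) := by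
    ext i k
    simp [Finset.sum_apply, Pi.single_apply]
  conv_lhs => rw [h]
  rw [← AlternatingMap.coe_multilinearMap, MultilinearMap.map_sum]
  refine Finset.sum_congr rfl fun a _ => ?_
  rw [MultilinearMap.map_smul_univ]
  rfl

theorem sum_cons {n p : ℕ} {A : Type*} [AddCommMonoid A] (g : (Fin (p + 1) → Fin n) → A) :
    ∑ a, g a = ∑ i, ∑ a : Fin p → Fin n, g (Fin.cons i a) := by
  rw [← (Fin.consEquiv fun _ => Fin n).sum_comp, Fintype.sum_prod_type]
  rfl

/-- Expansion of a mixed minor along its first matrix. -/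
theorem mixed_succ {n p : ℕ} (U W : AltForm n (p + 1))
    (H : Fin (p + 1) → Matrix (Fin n) (Fin n) ℝ) :
    mixed U W H = ∑ i, ∑ j, H 0 i j * mixed (U.contract i) (W.contract j) (fun k => H k.succ) := by
  simp only [mixed, sum_cons, AltForm.comp_cons, Fin.prod_univ_succ, Fin.cons_zero, Fin.cons_succ,
    Finset.mul_sum]
  refine Finset.sum_congr rfl fun i _ => ?_
  rw [Finset.sum_comm]
  refine Finset.sum_congr rfl fun j _ => Finset.sum_congr rfl fun a _ =>
    Finset.sum_congr rfl fun b _ => ?_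
  ring

/-- A polarized Cauchy–Binet formula. -/
theorem mixed_gram {n p : ℕ} (U W : AltForm n p) (B : Fin p → Matrix (Fin n) (Fin n) ℝ) :
    mixed U W (fun i => (B i).transpose * B i) =
      ∑ κ : Fin p → Fin n, U (fun i => B i (κ i)) * W (fun i => B i (κ i)) := by
  simp only [mixed, Matrix.mul_apply, Matrix.transpose_apply, Finset.prod_univ_sum,
    Fintype.piFinset_univ, AltForm.apply_eq_sum, Finset.sum_mul_sum]
  simp only [Finset.mul_sum]
  calc _ = ∑ a : Fin p → Fin n, ∑ κ : Fin p → Fin n, ∑ b : Fin p → Fin n,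
        U.comp a * W.comp b * ∏ i, B i (κ i) (a i) * B i (κ i) (b i) :=
      Finset.sum_congr rfl fun a _ => Finset.sum_comm
    _ = _ := by
      rw [Finset.sum_comm]
      refine Finset.sum_congr rfl fun κ _ => Finset.sum_congr rfl fun a _ =>
        Finset.sum_congr rfl fun b _ => ?_
      rw [Finset.prod_mul_distrib]
      ring

open scoped MatrixOrder in
theorem exists_gram {n : ℕ} {H : Matrix (Fin n) (Fin n) ℝ} (h : H.PosSemidef) :
    ∃ B : Matrix (Fin n) (Fin n) ℝ, H = B.transpose * B := by
  obtain ⟨X, hX, -, rfl⟩ := CFC.exists_sqrt_of_isSelfAdjoint_of_quasispectrumRestricts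
    h.isHermitian (QuasispectrumRestricts.nnreal_of_nonneg h.nonneg)
  refine ⟨X, ?_⟩
  have h := hX.star_eq
  rw [Matrix.star_eq_conjTranspose, Matrix.conjTranspose_eq_transpose_of_trivial] at h
  rw [h]

theorem mixed_self_nonneg {n p : ℕ} (U : AltForm n p) {H : Fin p → Matrix (Fin n) (Fin n) ℝ}
    (hH : ∀ i, (H i).PosSemidef) : 0 ≤ mixed U U H := by
  choose B hB using fun i => exists_gram (hH i)
  obtain rfl : H = fun i => (B i).transpose * B i := funext hB
  rw [mixed_gram]
  exact Finset.sum_nonneg fun κ _ => mul_self_nonneg _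

theorem abs_mixed_le {n p : ℕ} (U W : AltForm n p) {H : Fin p → Matrix (Fin n) (Fin n) ℝ}
    (hH : ∀ i, (H i).PosSemidef) : |mixed U W H| ≤ (mixed U U H + mixed W W H) / 2 := by
  choose B hB using fun i => exists_gram (hH i)
  obtain rfl : H = fun i => (B i).transpose * B i := funext hB
  simp only [mixed_gram, ← Finset.sum_add_distrib, Finset.sum_div]
  refine (Finset.abs_sum_le_sum_abs _ _).trans (Finset.sum_le_sum fun κ _ => ?_)
  rw [abs_le]
  constructor
  · nlinarith [sq_nonneg (U (fun i => B i (κ i)) + W (fun i => B i (κ i)))]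
  · nlinarith [sq_nonneg (U (fun i => B i (κ i)) - W (fun i => B i (κ i)))]

/-! ### Coefficients of products of super forms -/

/-- The constant form `dξᵢ`. -/
def dxi {n : ℕ} (i : Fin n) : ConstForm n :=
  ExteriorAlgebra.ι ℝ (Pi.single (Sum.inrₗ i) 1)

/-- The minor on the columns in `K` (and all rows) of the matrix with rows `v₁, …, v_p`. -/
def minor {n p : ℕ} (K : MultiIndex n p) : AltForm n p :=
  Matrix.detRowAlternating.compLinearMap
    (LinearMap.funLeft ℝ ℝ (K.1.orderEmbOfFin K.2))

theorem exists_perm_of_injective {I : Type*} [LinearOrder I] {m : ℕ} {c : Fin m → I}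
    (hc : Function.Injective c) {S : Finset I} (hS : S.card = m) (h : ∀ i, c i ∈ S) :
    ∃ σ : Equiv.Perm (Fin m), c = S.orderEmbOfFin hS ∘ σ := by
  refine ⟨Equiv.ofBijective (fun i => (S.orderIsoOfFin hS).symm ⟨c i, h i⟩)
    (Finite.injective_iff_bijective.1 fun i j hij => hc ?_), ?_⟩
  · simpa using hij
  · ext i
    simp [← Finset.coe_orderIsoOfFin_apply]

theorem minor_comp_orderEmb {n p : ℕ} (K : MultiIndex n p) :
    (minor K).comp (K.1.orderEmbOfFin K.2) = 1 := by
  have : (fun i => LinearMap.funLeft ℝ ℝ (K.1.orderEmbOfFin K.2)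
      (Pi.single (K.1.orderEmbOfFin K.2 i) 1)) = (1 : Matrix (Fin p) (Fin p) ℝ) := by
    ext i j
    simp [Pi.single_apply, Matrix.one_apply, LinearMap.funLeft_apply, eq_comm]
  simp only [AltForm.comp, minor, AlternatingMap.compLinearMap_apply]
  rw [this]
  exact Matrix.det_one

theorem minor_comp_eq_zero {n p : ℕ} (K : MultiIndex n p) {a : Fin p → Fin n} {i : Fin p}
    (h : a i ∉ K.1) : (minor K).comp a = 0 := by
  simp only [AltForm.comp, minor, AlternatingMap.compLinearMap_apply]
  refine Matrix.det_eq_zero_of_row_eq_zero i fun j => ?_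
  rw [LinearMap.funLeft_apply, Pi.single_apply, if_neg]
  rintro h'
  exact h (h' ▸ K.1.orderEmbOfFin_mem K.2 j)

theorem AltForm.comp_perm {n p : ℕ} (U : AltForm n p) (a : Fin p → Fin n)
    (σ : Equiv.Perm (Fin p)) : U.comp (a ∘ σ) = Equiv.Perm.sign σ • U.comp a :=
  U.map_perm (fun i => Pi.single (a i) 1) σ

/-- An alternating form that only involves the coordinates in `K`, `|K| = p`, is a multiple of
the minor on `K`. -/
theorem AltForm.eq_smul_minor {n p : ℕ} (U : AltForm n p) (K : MultiIndex n p)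
    (hU : ∀ a : Fin p → Fin n, ∀ i, a i ∉ K.1 → U.comp a = 0) :
    U = U.comp (K.1.orderEmbOfFin K.2) • minor K := by
  refine Module.Basis.ext_alternating (Pi.basisFun ℝ (Fin n)) fun a ha => ?_
  simp only [Pi.basisFun_apply]
  change U.comp a = U.comp _ * (minor K).comp a
  by_cases h : ∀ i, a i ∈ K.1
  · obtain ⟨σ, rfl⟩ := exists_perm_of_injective ha K.2 h
    rw [comp_perm, comp_perm, minor_comp_orderEmb]
    simp [Units.smul_def, mul_comm]
  · push Not at h
    obtain ⟨i, hi⟩ := h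
    rw [hU a i hi, minor_comp_eq_zero K hi, mul_zero]

theorem inl_mem_superIndex {n : ℕ} {K L : Finset (Fin n)} {i : Fin n} :
    Sum.inlₗ i ∈ superIndex K L ↔ i ∈ K := by
  simp [superIndex, Sum.inlₗ]

theorem inr_mem_superIndex {n : ℕ} {K L : Finset (Fin n)} {i : Fin n} :
    Sum.inrₗ i ∈ superIndex K L ↔ i ∈ L := by
  simp [superIndex, Sum.inrₗ]

theorem ext_lexSum {n : ℕ} {S T : Finset (Fin n ⊕ₗ Fin n)}
    (hl : ∀ i, Sum.inlₗ i ∈ S ↔ Sum.inlₗ i ∈ T) (hr : ∀ i, Sum.inrₗ i ∈ S ↔ Sum.inrₗ i ∈ T) :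
    S = T := by
  ext c
  obtain ⟨c, rfl⟩ := toLex.surjective c
  rcases c with i | i
  exacts [hl i, hr i]

/-- Sets of basis covectors correspond to pairs of multi-indices. -/
def superIndexEquiv (n : ℕ) :
    Finset (Fin n) × Finset (Fin n) ≃ Finset (Fin n ⊕ₗ Fin n) where
  toFun q := superIndex q.1 q.2
  invFun S := (Finset.univ.filter fun i => Sum.inlₗ i ∈ S,
    Finset.univ.filter fun i => Sum.inrₗ i ∈ S)
  left_inv q := by ext <;> simp [inl_mem_superIndex, inr_mem_superIndex]
  right_inv S := ext_lexSum (by simp [inl_mem_superIndex]) (by simp [inr_mem_superIndex])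

theorem sum_coeff_smul_monomial {n : ℕ} (v : ConstForm n) :
    ∑ K, ∑ L, coeff K L v • monomial K L = v := by
  rw [← Fintype.sum_prod_type' (f := fun K L => coeff K L v • monomial K L)]
  conv_rhs => rw [← (formBasis n).sum_repr v, ← (superIndexEquiv n).sum_comp]
  rfl

theorem coeff_formBasis {n : ℕ} (K L : Finset (Fin n)) (S : Finset (Fin n ⊕ₗ Fin n)) :
    coeff K L (formBasis n S) = if S = superIndex K L then 1 else 0 := by
  simp [coeff, Finsupp.single_apply]

theorem ιMulti_eq_sign_smul_formBasis {n m : ℕ} {c : Fin m → Fin n ⊕ₗ Fin n}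
    (hc : Function.Injective c) : ∃ s : ℤˣ, ExteriorAlgebra.ιMulti ℝ m
      (fun i => (Pi.single (c i) 1 : Covector n)) =
        s • formBasis n (Finset.univ.image c) := by
  have hS : (Finset.univ.image c).card = m := by
    rw [Finset.card_image_of_injective _ hc, Finset.card_univ, Fintype.card_fin]
  obtain ⟨σ, h⟩ := exists_perm_of_injective hc hS (by simp)
  refine ⟨Equiv.Perm.sign σ, ?_⟩
  rw [formBasis, ExteriorAlgebra.basis_apply_ofCard _ hS, ← AlternatingMap.map_perm]
  congr 1
  ext1 i
  simp only [Function.comp_apply, Pi.basisFun_apply, Set.powersetCard.ofFinEmbEquiv_symm_apply]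
  rw [congrFun h i]
  rfl

theorem coeff_ιMulti_mul_ιMulti_eq_zero {n p : ℕ} (K L : Finset (Fin n)) (a b : Fin p → Fin n)
    (h : ¬ ((∀ i, a i ∈ K) ∧ ∀ i, b i ∈ L)) :
    coeff K L (ExteriorAlgebra.ιMulti ℝ p (fun i => (Pi.single (Sum.inlₗ (a i)) 1 : Covector n)) *
      ExteriorAlgebra.ιMulti ℝ p (fun i => (Pi.single (Sum.inrₗ (b i)) 1 : Covector n))) = 0 := by
  rw [ExteriorAlgebra.ιMulti_mul_ιMulti]
  set c : Fin (p + p) → Fin n ⊕ₗ Fin n :=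
    Fin.append (fun i => Sum.inlₗ (a i)) (fun i => Sum.inrₗ (b i))
  have hv : Fin.append (fun i => (Pi.single (Sum.inlₗ (a i)) 1 : Covector n))
      (fun i => Pi.single (Sum.inrₗ (b i)) 1) = fun i => Pi.single (c i) 1 := by
    ext1 i
    refine Fin.addCases (fun i => ?_) (fun i => ?_) i <;> simp [c, -Fin.natAdd_eq_addNat]
  rw [hv]
  by_cases hc : Function.Injective c
  · obtain ⟨s, hs⟩ := ιMulti_eq_sign_smul_formBasis hc
    rw [hs, Units.smul_def, map_zsmul, coeff_formBasis, if_neg, smul_zero]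
    intro hS
    refine h ⟨fun i => ?_, fun i => ?_⟩
    · rw [← inl_mem_superIndex (L := L), ← hS, Finset.mem_image]
      exact ⟨Fin.castAdd p i, Finset.mem_univ _, by simp [c]⟩
    · rw [← inr_mem_superIndex (K := K), ← hS, Finset.mem_image]
      exact ⟨Fin.natAdd p i, Finset.mem_univ _, by simp [c, -Fin.natAdd_eq_addNat]⟩
  · rw [ExteriorAlgebra.ιMulti_eq_zero_of_not_inj, map_zero]
    refine fun h' => hc fun i j hij => h' ?_
    simp [hij]

/-- The linear map from `ℝⁿ` to covectors given by a map of the index sets. -/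
def covectorMap {n : ℕ} (e : Fin n → Fin n ⊕ₗ Fin n) : (Fin n → ℝ) →ₗ[ℝ] Covector n :=
  Fintype.linearCombination ℝ fun i => Pi.single (e i) 1

theorem covectorMap_single {n : ℕ} (e : Fin n → Fin n ⊕ₗ Fin n) (i : Fin n) :
    covectorMap e (Pi.single i 1) = Pi.single (e i) 1 := by
  simp [covectorMap]

/-- The coefficient of `dx_K ∧ dξ_L` in `dx_{a₁} ∧ … ∧ dx_{a_p} ∧ dξ_{b₁} ∧ … ∧ dξ_{b_p}`
is a product of two minors, up to a constant factor. -/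
theorem exists_coeff_ιMulti_mul_ιMulti {n p : ℕ} (K L : MultiIndex n p) :
    ∃ s : ℝ, ∀ a b : Fin p → Fin n, coeff K.1 L.1
      (ExteriorAlgebra.ιMulti ℝ p (fun i => (Pi.single (Sum.inlₗ (a i)) 1 : Covector n)) *
        ExteriorAlgebra.ιMulti ℝ p (fun i => (Pi.single (Sum.inrₗ (b i)) 1 : Covector n))) =
      s * ((minor K).comp a * (minor L).comp b) := by
  let A : (Fin n → ℝ) [⋀^Fin p]→ₗ[ℝ] ConstForm n :=
    (ExteriorAlgebra.ιMulti ℝ p).compLinearMap (covectorMap fun i => Sum.inlₗ i)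
  let B : (Fin n → ℝ) [⋀^Fin p]→ₗ[ℝ] ConstForm n :=
    (ExteriorAlgebra.ιMulti ℝ p).compLinearMap (covectorMap fun i => Sum.inrₗ i)
  have hA (a : Fin p → Fin n) : A (fun i => Pi.single (a i) 1) =
      ExteriorAlgebra.ιMulti ℝ p fun i => (Pi.single (Sum.inlₗ (a i)) 1 : Covector n) := by
    simp [A, covectorMap_single]
  have hB (b : Fin p → Fin n) : B (fun i => Pi.single (b i) 1) =
      ExteriorAlgebra.ιMulti ℝ p fun i => (Pi.single (Sum.inrₗ (b i)) 1 : Covector n) := by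
    simp [B, covectorMap_single]
  let U (b : Fin p → Fin n) : AltForm n p := (coeff K.1 L.1 ∘ₗ
    LinearMap.mulRight ℝ (B fun i => Pi.single (b i) 1)).compAlternatingMap A
  let W (a : Fin p → Fin n) : AltForm n p := (coeff K.1 L.1 ∘ₗ
    LinearMap.mulLeft ℝ (A fun i => Pi.single (a i) 1)).compAlternatingMap B
  have hUW (a b : Fin p → Fin n) : (U b).comp a = (W a).comp b := rfl
  have hU (a b : Fin p → Fin n) : (U b).comp a = coeff K.1 L.1
      (ExteriorAlgebra.ιMulti ℝ p (fun i => (Pi.single (Sum.inlₗ (a i)) 1 : Covector n)) *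
        ExteriorAlgebra.ιMulti ℝ p (fun i => (Pi.single (Sum.inrₗ (b i)) 1 : Covector n))) := by
    rw [← hA, ← hB]
    rfl
  refine ⟨(U (L.1.orderEmbOfFin L.2)).comp (K.1.orderEmbOfFin K.2), fun a b => ?_⟩
  rw [← hU, (U b).eq_smul_minor K]
  · change (U b).comp _ * (minor K).comp a = _
    rw [hUW, (W _).eq_smul_minor L]
    · change (W _).comp _ * (minor L).comp b * (minor K).comp a = _
      rw [← hUW]
      ring
    · intro b i hb
      rw [← hUW, hU]
      exact coeff_ιMulti_mul_ιMulti_eq_zero _ _ _ _ fun h => hb (h.2 i)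
  · intro a i ha
    rw [hU]
    exact coeff_ιMulti_mul_ιMulti_eq_zero _ _ _ _ fun h => ha (h.1 i)

theorem ι_mul_prod_comm {M : Type*} [AddCommGroup M] [Module ℝ M] {p : ℕ} (m : M)
    (v : Fin p → M) : ExteriorAlgebra.ι ℝ m * ExteriorAlgebra.ιMulti ℝ p v =
      (-1 : ℝ) ^ p • (ExteriorAlgebra.ιMulti ℝ p v * ExteriorAlgebra.ι ℝ m) := by
  induction p with
  | zero => simp
  | succ p ih =>
    have h := eq_neg_of_add_eq_zero_left (ExteriorAlgebra.ι_add_mul_swap (R := ℝ) m (v 0))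
    rw [ExteriorAlgebra.ιMulti_succ_apply, ← mul_assoc, h, neg_mul, mul_assoc, ih, pow_succ]
    simp [mul_assoc]

/-- Sorting the factors of `(v₁ ∧ w₁) ∧ … ∧ (v_p ∧ w_p)` costs a sign that depends on `p` only. -/
theorem exists_prod_eq_ιMulti_mul_ιMulti (M : Type*) [AddCommGroup M] [Module ℝ M] (p : ℕ) :
    ∃ s : ℝ, ∀ v w : Fin p → M,
      (List.ofFn fun i => ExteriorAlgebra.ι ℝ (v i) * ExteriorAlgebra.ι ℝ (w i)).prod =
        s • (ExteriorAlgebra.ιMulti ℝ p v * ExteriorAlgebra.ιMulti ℝ p w) := by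
  induction p with
  | zero => exact ⟨1, by simp⟩
  | succ p ih =>
    obtain ⟨s, hs⟩ := ih
    refine ⟨s * (-1) ^ p, fun v w => ?_⟩
    rw [List.ofFn_succ, List.prod_cons, hs, ExteriorAlgebra.ιMulti_succ_apply,
      ExteriorAlgebra.ιMulti_succ_apply]
    change _ * (s • (ExteriorAlgebra.ιMulti ℝ p (Matrix.vecTail v) *
      ExteriorAlgebra.ιMulti ℝ p (Matrix.vecTail w))) = _
    rw [mul_smul_comm, mul_assoc, ← mul_assoc (ExteriorAlgebra.ι ℝ (w 0)), ι_mul_prod_comm,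
      smul_mul_assoc, mul_smul_comm, smul_smul]
    simp only [mul_assoc]

theorem prod_sum_smul {n p : ℕ} (H : Fin p → Matrix (Fin n) (Fin n) ℝ) :
    (List.ofFn fun k => ∑ i, ∑ j, H k i j • (dx i * dxi j)).prod =
      ∑ a : Fin p → Fin n, ∑ b : Fin p → Fin n,
        (∏ k, H k (a k) (b k)) • (List.ofFn fun k => dx (a k) * dxi (b k)).prod := by
  induction p with
  | zero => simp
  | succ p ih =>
    rw [List.ofFn_succ, List.prod_cons, ih fun k => H k.succ]
    simp only [sum_cons, Fin.prod_univ_succ, Fin.cons_zero, Fin.cons_succ, List.ofFn_succ,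
      List.prod_cons, Finset.sum_mul]
    refine Finset.sum_congr rfl fun i _ => ?_
    conv_rhs => rw [Finset.sum_comm]
    simp only [Finset.mul_sum, smul_mul_smul_comm]

/-- The coefficients of a product of `(1, 1)`-forms are mixed minors; the alternating forms in
question are the minors on `K` and on `L`, one of them multiplied by a constant. -/
theorem exists_coeff_prod_eq_mixed {n p : ℕ} (K L : MultiIndex n p) :
    ∃ U W : AltForm n p, ∀ H : Fin p → Matrix (Fin n) (Fin n) ℝ,
      coeff K.1 L.1 (List.ofFn fun k => ∑ i, ∑ j, H k i j • (dx i * dxi j)).prod =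
        mixed U W H := by
  obtain ⟨s, hs⟩ := exists_coeff_ιMulti_mul_ιMulti K L
  obtain ⟨t, ht⟩ := exists_prod_eq_ιMulti_mul_ιMulti (Covector n) p
  refine ⟨(t * s) • minor K, minor L, fun H => ?_⟩
  have hc (a : Fin p → Fin n) : ((t * s) • minor K).comp a = t * s * (minor K).comp a := rfl
  rw [prod_sum_smul]
  simp only [dx, dxi, ht, map_sum, map_smul, hs, mixed, hc, smul_eq_mul]
  refine Finset.sum_congr rfl fun a _ => Finset.sum_congr rfl fun b _ => ?_
  ring

theorem pairingSign_ne_zero {n : ℕ} (K L : Finset (Fin n)) : pairingSign K L ≠ 0 := by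
  let s : Set.powersetCard (Fin n ⊕ₗ Fin n) (superIndex K L).card := ⟨superIndex K L, rfl⟩
  let t : Set.powersetCard (Fin n ⊕ₗ Fin n) (superIndex Kᶜ Lᶜ).card := ⟨superIndex Kᶜ Lᶜ, rfl⟩
  have h : Disjoint s.val t.val := by
    rw [Finset.disjoint_left]
    intro c
    obtain ⟨c, rfl⟩ := toLex.surjective c
    rcases c with i | i
    · change Sum.inlₗ i ∈ superIndex K L → Sum.inlₗ i ∉ superIndex Kᶜ Lᶜ
      simp [inl_mem_superIndex]
    · change Sum.inrₗ i ∈ superIndex K L → Sum.inrₗ i ∉ superIndex Kᶜ Lᶜ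
      simp [inr_mem_superIndex]
  have hu : (Set.powersetCard.disjUnion h : Finset (Fin n ⊕ₗ Fin n)) =
      superIndex Finset.univ Finset.univ := by
    refine ext_lexSum (fun i => ?_) (fun i => ?_)
    · simp [s, t, inl_mem_superIndex, em]
    · simp [s, t, inr_mem_superIndex, em]
  have hm : monomial K L * monomial Kᶜ Lᶜ = _ :=
    ExteriorAlgebra.basis_mul_of_disjoint (Pi.basisFun ℝ (Fin n ⊕ₗ Fin n)) s t h
  rw [pairingSign, topCoeff, hm, hu, Units.smul_def, map_zsmul]
  have : coeff Finset.univ Finset.univ ((Pi.basisFun ℝ (Fin n ⊕ₗ Fin n)).ExteriorAlgebra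
      (superIndex Finset.univ Finset.univ)) = 1 :=
    (coeff_formBasis _ _ _).trans (if_pos rfl)
  rw [this]
  simp

/-! ### Hessians and the coefficients of `dd^# f₁ ∧ … ∧ dd^# f_p` -/

/-- The partial derivative `∂f / ∂xᵢ`. -/
def pd {n : ℕ} (i : Fin n) (f : V n → ℝ) : V n → ℝ :=
  fun x => fderiv ℝ f x (EuclideanSpace.single i 1)

/-- The Hessian matrix. -/
def hess {n : ℕ} (f : V n → ℝ) (x : V n) : Matrix (Fin n) (Fin n) ℝ :=
  Matrix.of fun i j => pd i (pd j f) x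

/-- The mixed minor of the Hessians of `f₁, …, f_p` that belongs to `U` and `W`. -/
def mixedDensity {n p : ℕ} (U W : AltForm n p) (f : Fin p → V n → ℝ) (x : V n) : ℝ :=
  mixed U W fun i => hess (f i) x

theorem contDiff_pd {n : ℕ} {f : V n → ℝ} (hf : ContDiff ℝ ∞ f) (i : Fin n) :
    ContDiff ℝ ∞ (pd i f) :=
  (hf.fderiv_right (m := ∞) le_rfl).clm_apply contDiff_const

theorem pd_comm {n : ℕ} {f : V n → ℝ} (hf : ContDiff ℝ ∞ f) (i j : Fin n) (x : V n) :
    pd i (pd j f) x = pd j (pd i f) x := by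
  have hd : DifferentiableAt ℝ (fderiv ℝ f) x :=
    (hf.fderiv_right (m := ∞) le_rfl).differentiable (by simp) x
  have h (v w : V n) : fderiv ℝ (fun y => fderiv ℝ f y v) x w = fderiv ℝ (fderiv ℝ f) x w v := by
    rw [fderiv_clm_apply hd (differentiableAt_const v)]
    simp
  have hs : minSmoothness ℝ 2 ≤ ∞ := by
    rw [minSmoothness_of_isRCLikeNormedField]
    exact ENat.LEInfty.out
  change fderiv ℝ (fun y => fderiv ℝ f y _) x _ = fderiv ℝ (fun y => fderiv ℝ f y _) x _
  rw [h, h]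
  exact (hf.contDiffAt.isSymmSndFDerivAt hs) _ _

/-- `d` may be computed from any representation of a form as a sum of constant forms with
function coefficients, not only in the basis of monomials. -/
theorem d_sum_smul {n : ℕ} {ι : Type*} [Fintype ι] (c : ι → V n → ℝ) (a : ι → ConstForm n)
    (hc : ∀ j, Differentiable ℝ (c j)) (x : V n) :
    d (fun y => ∑ j, c j y • a j) x = ∑ i, ∑ j, pd i (c j) x • (dx i * a j) := by
  have h (K L : Finset (Fin n)) (i : Fin n) :
      fderiv ℝ (fun y => coeff K L (∑ j, c j y • a j)) x (EuclideanSpace.single i 1) =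
        coeff K L (∑ j, pd i (c j) x • a j) := by
    simp only [map_sum, map_smul, smul_eq_mul]
    rw [fderiv_fun_sum fun j _ => (hc j x).mul_const _]
    simp only [sum_apply]
    refine Finset.sum_congr rfl fun j _ => ?_
    rw [fderiv_mul_const (hc j x)]
    simp [pd, mul_comm]
  simp only [d, h]
  calc _ = ∑ i, dx i * ∑ K, ∑ L, coeff K L (∑ j, pd i (c j) x • a j) • monomial K L := by
        rw [Finset.sum_congr rfl fun K _ => Finset.sum_comm, Finset.sum_comm]
        simp only [Finset.mul_sum, mul_smul_comm]
    _ = _ := by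
        simp only [sum_coeff_smul_monomial, Finset.mul_sum, mul_smul_comm]

theorem J_dx {n : ℕ} (i : Fin n) : J (dx i) = dxi i := by
  rw [J, dx, ExteriorAlgebra.map_apply_ι, dxi]
  congr 1
  ext c
  obtain ⟨c, rfl⟩ := toLex.surjective c
  simp only [LinearMap.funLeft_apply, Pi.single_apply]
  rcases c with j | j <;> simp [Sum.inlₗ, Sum.inrₗ]

theorem ddSharp_eq {n : ℕ} {f : V n → ℝ} (hf : ContDiff ℝ ∞ f) (x : V n) :
    ddSharp f x = ∑ i, ∑ j, hess f x i j • (dx i * dxi j) := by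
  have h1 : (fun y => J (algebraMap ℝ (ConstForm n) (f y))) =
      fun y => ∑ _j : Unit, f y • (1 : ConstForm n) := by
    ext1 y
    simp [Algebra.algebraMap_eq_smul_one]
  have h2 : dSharp (fun y => algebraMap ℝ (ConstForm n) (f y)) =
      fun y => ∑ j, pd j f y • dxi j := by
    ext1 y
    rw [dSharp, h1, d_sum_smul (fun _ => f) (fun _ => 1) fun _ => hf.differentiable (by simp)]
    simp [J_dx]
  rw [ddSharp, h2, d_sum_smul _ _ fun j => (contDiff_pd hf j).differentiable (by simp)]
  rfl

/-- The coefficients of `dd^# f₁ ∧ … ∧ dd^# f_p` are mixed minors of Hessians. -/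
theorem exists_coeff_wedgeDDSharp {n p : ℕ} (K L : MultiIndex n p) :
    ∃ U W : AltForm n p, ∀ f : Fin p → V n → ℝ, (∀ i, ContDiff ℝ ∞ (f i)) → ∀ x,
      coeff K.1 L.1 (wedgeDDSharp f x) = mixedDensity U W f x := by
  obtain ⟨U, W, h⟩ := exists_coeff_prod_eq_mixed K L
  refine ⟨U, W, fun f hf x => ?_⟩
  rw [mixedDensity, ← h, wedgeDDSharp]
  simp only [ddSharp_eq (hf _)]

theorem contDiff_mixedDensity {n p : ℕ} (U W : AltForm n p) {f : Fin p → V n → ℝ}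
    (hf : ∀ i, ContDiff ℝ ∞ (f i)) : ContDiff ℝ ∞ (mixedDensity U W f) := by
  unfold mixedDensity mixed
  exact ContDiff.sum fun a _ => ContDiff.sum fun b _ => contDiff_const.mul
    (contDiff_prod fun i _ => contDiff_pd (contDiff_pd (hf i) _) _)

theorem mixedDensity_comm {n p : ℕ} (U W : AltForm n p) {f : Fin p → V n → ℝ}
    (hf : ∀ i, ContDiff ℝ ∞ (f i)) : mixedDensity U W f = mixedDensity W U f := by
  ext x
  simp only [mixedDensity, mixed]
  rw [Finset.sum_comm]
  refine Finset.sum_congr rfl fun a _ => Finset.sum_congr rfl fun b _ => ?_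
  rw [mul_comm (U.comp b)]
  congr 1
  exact Finset.prod_congr rfl fun i _ => pd_comm (hf i) _ _ x

theorem posSemidef_hess {n : ℕ} {f : V n → ℝ} (hf : ContDiff ℝ ∞ f)
    (hc : ConvexOn ℝ Set.univ f) (x : V n) : (hess f x).PosSemidef := by
  refine Matrix.PosSemidef.of_dotProduct_mulVec_nonneg ?_ fun v => ?_
  · ext i j
    exact pd_comm hf j i x
  have hd : Differentiable ℝ f := hf.differentiable (by simp)
  let w : V n := ∑ i, v i • EuclideanSpace.single i 1
  -- the second derivative at `0` of the convex function `t ↦ f (x + t w)`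
  let l : ℝ → V n := fun t => x + t • w
  have hl (t : ℝ) : HasDerivAt l w t := by
    have := ((hasDerivAt_id t).smul_const w).const_add x
    rwa [one_smul] at this
  have h1 (g : V n → ℝ) (hg : Differentiable ℝ g) (t : ℝ) :
      HasDerivAt (fun t => g (l t)) (∑ i, v i * pd i g (l t)) t := by
    have := (hg (l t)).hasFDerivAt.comp_hasDerivAt t (hl t)
    rw [show fderiv ℝ g (l t) w = ∑ i, v i * pd i g (l t) by simp [w, pd]] at this
    exact this
  have hcl : ConvexOn ℝ Set.univ fun t => f (l t) := by
    have := hc.comp_affineMap (AffineMap.lineMap x (x + w))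
    have he : (f ∘ (AffineMap.lineMap x (x + w) : ℝ →ᵃ[ℝ] V n)) = fun t => f (l t) := by
      ext t
      simp [l, AffineMap.lineMap_apply, add_comm]
    rwa [he] at this
  have hmono : Monotone fun t => ∑ i, v i * pd i f (l t) := by
    have := hcl.monotoneOn_deriv fun t _ => (h1 f hd t).differentiableAt
    rw [monotoneOn_univ] at this
    convert this using 2 with t
    exact (h1 f hd t).deriv.symm
  have h2 : HasDerivAt (fun t => ∑ j, v j * pd j f (l t))
      (∑ j, v j * ∑ i, v i * pd i (pd j f) (l 0)) 0 :=
    HasDerivAt.fun_sum fun j _ =>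
      (h1 _ ((contDiff_pd hf j).differentiable (by simp)) 0).const_mul (v j)
  have h3 := h2.nonneg_of_monotone hmono
  simp only [l, zero_smul, add_zero] at h3
  refine h3.trans_eq ?_
  simp only [dotProduct, Matrix.mulVec, hess, Matrix.of_apply, Pi.star_apply, star_trivial]
  refine Finset.sum_congr rfl fun j _ => ?_
  congr 1
  refine Finset.sum_congr rfl fun i _ => ?_
  rw [pd_comm hf, mul_comm]

/-! ### Integration by parts -/

/-- Contracting the alternating form `U` with the derivative kills the mixed minors of Hessians,
because derivatives commute. -/
theorem sum_pd_mixedDensity {n p : ℕ} (U : AltForm n (p + 1)) (W : AltForm n p)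
    {f : Fin p → V n → ℝ} (hf : ∀ i, ContDiff ℝ ∞ (f i)) (x : V n) :
    ∑ i, pd i (mixedDensity (U.contract i) W f) x = 0 := by
  have hd (l : Fin p) (i j : Fin n) : DifferentiableAt ℝ (fun y => hess (f l) y i j) x :=
    (contDiff_pd (contDiff_pd (hf l) j) i).differentiable (by simp) x
  have h1 (U : AltForm n p) (i : Fin n) : pd i (mixedDensity U W f) x =
      ∑ a : Fin p → Fin n, ∑ b : Fin p → Fin n, U.comp a * W.comp b *
        ∑ l, (∏ m ∈ Finset.univ.erase l, hess (f m) x (a m) (b m)) *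
          pd i (fun y => hess (f l) y (a l) (b l)) x := by
    have := HasFDerivAt.fun_sum (u := Finset.univ) fun (a : Fin p → Fin n) _ =>
      HasFDerivAt.fun_sum (u := Finset.univ) fun (b : Fin p → Fin n) _ =>
        (HasFDerivAt.finsetProd (u := Finset.univ)
          fun l _ => (hd l (a l) (b l)).hasFDerivAt).const_mul (U.comp a * W.comp b)
    rw [pd]
    unfold mixedDensity mixed
    rw [this.fderiv]
    simp [pd]
  have h2 (b : Fin p → Fin n) (l : Fin p) : ∑ c : Fin (p + 1) → Fin n, U.comp c *
      ((∏ m ∈ Finset.univ.erase l, hess (f m) x (c m.succ) (b m)) *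
        pd (c 0) (pd (c l.succ) (pd (b l) (f l))) x) = 0 := by
    -- exchanging `c 0` and `c l.succ` changes the sign of `U` and preserves the other factor
    have h := (Equiv.arrowCongr (Equiv.swap 0 l.succ) (Equiv.refl (Fin n))).sum_comp
      fun c : Fin (p + 1) → Fin n => U.comp c *
        ((∏ m ∈ Finset.univ.erase l, hess (f m) x (c m.succ) (b m)) *
          pd (c 0) (pd (c l.succ) (pd (b l) (f l))) x)
    have h' (c : Fin (p + 1) → Fin n) :
        Equiv.arrowCongr (Equiv.swap 0 l.succ) (Equiv.refl (Fin n)) c =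
          c ∘ Equiv.swap 0 l.succ := by
      ext; simp
    simp only [h', U.comp_swap _ (Fin.succ_ne_zero l).symm, Function.comp_apply,
      Equiv.swap_apply_left, Equiv.swap_apply_right] at h
    have h3 (c : Fin (p + 1) → Fin n) :
        ∏ m ∈ Finset.univ.erase l, hess (f m) x (c (Equiv.swap 0 l.succ m.succ)) (b m) =
          ∏ m ∈ Finset.univ.erase l, hess (f m) x (c m.succ) (b m) := by
      refine Finset.prod_congr rfl fun m hm => ?_
      rw [Equiv.swap_apply_of_ne_of_ne (Fin.succ_ne_zero m)
        (fun h => Finset.ne_of_mem_erase hm (Fin.succ_injective _ h))]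
    simp only [h3, fun c : Fin (p + 1) → Fin n =>
      pd_comm (contDiff_pd (hf l) (b l)) (c l.succ) (c 0) x, neg_mul,
      Finset.sum_neg_distrib] at h
    linarith
  calc _ = ∑ b : Fin p → Fin n, ∑ l, W.comp b * ∑ c : Fin (p + 1) → Fin n, U.comp c *
      ((∏ m ∈ Finset.univ.erase l, hess (f m) x (c m.succ) (b m)) *
        pd (c 0) (pd (c l.succ) (pd (b l) (f l))) x) := by
        simp only [h1, sum_cons, AltForm.comp_cons, Fin.cons_zero, Fin.cons_succ, Finset.mul_sum]
        rw [Finset.sum_congr rfl fun i _ => Finset.sum_comm, Finset.sum_comm]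
        refine Finset.sum_congr rfl fun b _ => ?_
        rw [Finset.sum_congr rfl fun i _ => Finset.sum_comm, Finset.sum_comm]
        refine Finset.sum_congr rfl fun l _ => Finset.sum_congr rfl fun i _ =>
          Finset.sum_congr rfl fun a _ => ?_
        change _ * (_ * pd i (pd (a l) (pd (b l) (f l))) x) = _
        ring
    _ = 0 := by simp only [h2, mul_zero, Finset.sum_const_zero]

theorem integrable_mul_of_hasCompactSupport {n : ℕ} {u v : V n → ℝ} (hu : Continuous u)
    (hs : HasCompactSupport u) (hv : Continuous v) : Integrable fun x => u x * v x :=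
  (hu.mul hv).integrable_of_hasCompactSupport hs.mul_right

theorem hasCompactSupport_pd {n : ℕ} {φ : V n → ℝ} (hs : HasCompactSupport φ) (i : Fin n) :
    HasCompactSupport (pd i φ) :=
  hs.fderiv_apply ℝ _

theorem tsupport_pd_subset {n : ℕ} (i : Fin n) (φ : V n → ℝ) :
    tsupport (pd i φ) ⊆ tsupport φ :=
  tsupport_fderiv_apply_subset ℝ _

/-- Integration by parts against a divergence-free vector field. -/
theorem integral_mul_sum_pd_mul {n : ℕ} {φ g : V n → ℝ} {X : Fin n → V n → ℝ}
    (hφ : ContDiff ℝ ∞ φ) (hs : HasCompactSupport φ) (hg : ContDiff ℝ ∞ g)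
    (hX : ∀ i, ContDiff ℝ ∞ (X i)) (hdiv : ∀ x, ∑ i, pd i (X i) x = 0) :
    ∫ x, φ x * ∑ i, pd i g x * X i x = -∫ x, g x * ∑ i, pd i φ x * X i x := by
  have hi (i : Fin n) : ∫ x, φ x * X i x * pd i g x =
      -∫ x, pd i φ x * (X i x * g x) + φ x * (pd i (X i) x * g x) := by
    have hd : Differentiable ℝ φ := hφ.differentiable (by simp)
    have hXd : Differentiable ℝ (X i) := (hX i).differentiable (by simp)
    have h1 (x : V n) : fderiv ℝ (fun y => φ y * X i y) x (EuclideanSpace.single i 1) * g x =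
        pd i φ x * (X i x * g x) + φ x * (pd i (X i) x * g x) := by
      rw [fderiv_fun_mul (hd x) (hXd x)]
      simp [pd]
      ring
    simp only [← h1]
    refine integral_mul_fderiv_eq_neg_fderiv_mul_of_integrable ?_ ?_ ?_
      (fun x _ => (hd x).mul (hXd x)) (fun x _ => hg.differentiable (by simp) x)
    · simp only [h1]
      exact (integrable_mul_of_hasCompactSupport (contDiff_pd hφ i).continuous
        (hasCompactSupport_pd hs i) ((hX i).continuous.mul hg.continuous)).add
        (integrable_mul_of_hasCompactSupport hφ.continuous hs
          ((contDiff_pd (hX i) i).continuous.mul hg.continuous))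
    · exact ((hφ.continuous.mul (hX i).continuous).mul
        (contDiff_pd hg i).continuous).integrable_of_hasCompactSupport hs.mul_right.mul_right
    · exact ((hφ.continuous.mul (hX i).continuous).mul
        hg.continuous).integrable_of_hasCompactSupport hs.mul_right.mul_right
  have e1 (x : V n) : φ x * ∑ i, pd i g x * X i x = ∑ i, φ x * X i x * pd i g x := by
    rw [Finset.mul_sum]
    exact Finset.sum_congr rfl fun i _ => by ring
  have e2 (x : V n) : g x * ∑ i, pd i φ x * X i x =
      ∑ i, (pd i φ x * (X i x * g x) + φ x * (pd i (X i) x * g x)) := by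
    rw [Finset.sum_add_distrib, ← Finset.mul_sum, ← Finset.sum_mul, hdiv, zero_mul, mul_zero,
      add_zero, Finset.mul_sum]
    exact Finset.sum_congr rfl fun i _ => by ring
  simp only [e1, e2]
  rw [integral_finsetSum, integral_finsetSum, ← Finset.sum_neg_distrib]
  · exact Finset.sum_congr rfl fun i _ => hi i
  · exact fun i _ => (integrable_mul_of_hasCompactSupport (contDiff_pd hφ i).continuous
        (hasCompactSupport_pd hs i) ((hX i).continuous.mul hg.continuous)).add
        (integrable_mul_of_hasCompactSupport hφ.continuous hs
          ((contDiff_pd (hX i) i).continuous.mul hg.continuous))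
  · exact fun i _ => ((hφ.continuous.mul (hX i).continuous).mul
        (contDiff_pd hg i).continuous).integrable_of_hasCompactSupport hs.mul_right.mul_right

/-- Both derivatives of `f₁` in a mixed minor of Hessians can be moved to the test function. -/
theorem integral_mul_mixedDensity {n p : ℕ} (U W : AltForm n (p + 1))
    {f : Fin (p + 1) → V n → ℝ} (hf : ∀ i, ContDiff ℝ ∞ (f i)) {φ : V n → ℝ}
    (hφ : ContDiff ℝ ∞ φ) (hs : HasCompactSupport φ) :
    ∫ x, φ x * mixedDensity U W f x = ∑ i, ∑ j, ∫ x, f 0 x * pd j (pd i φ) x *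
      mixedDensity (U.contract i) (W.contract j) (fun k => f k.succ) x := by
  set C : Fin n → Fin n → V n → ℝ := fun i j =>
    mixedDensity (U.contract i) (W.contract j) fun k => f k.succ with hC
  have hCd (i j : Fin n) : ContDiff ℝ ∞ (C i j) := contDiff_mixedDensity _ _ fun k => hf _
  have hC1 (j : Fin n) (x : V n) : ∑ i, pd i (C i j) x = 0 :=
    sum_pd_mixedDensity _ _ (fun k => hf _) x
  have hC2 (i : Fin n) (x : V n) : ∑ j, pd j (C i j) x = 0 := by
    simp only [hC, mixedDensity_comm (U.contract i) _ fun k => hf (Fin.succ k)]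
    exact sum_pd_mixedDensity _ _ (fun k => hf _) x
  have e (x : V n) : φ x * mixedDensity U W f x =
      ∑ j, φ x * ∑ i, pd i (pd j (f 0)) x * C i j x := by
    rw [mixedDensity, mixed_succ, Finset.sum_comm, Finset.mul_sum]
    rfl
  have h1 : ∫ x, φ x * mixedDensity U W f x =
      ∑ j, ∫ x, φ x * ∑ i, pd i (pd j (f 0)) x * C i j x := by
    simp only [e]
    refine integral_finsetSum _ fun j _ => integrable_mul_of_hasCompactSupport hφ.continuous hs ?_
    exact continuous_finsetSum _ fun i _ =>
      (contDiff_pd (contDiff_pd (hf 0) j) i).continuous.mul (hCd i j).continuous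
  have h2 (j : Fin n) : ∫ x, φ x * ∑ i, pd i (pd j (f 0)) x * C i j x =
      -∑ i, ∫ x, pd i φ x * (pd j (f 0) x * C i j x) := by
    rw [integral_mul_sum_pd_mul hφ hs (contDiff_pd (hf 0) j) (fun i => hCd i j) (hC1 j),
      ← integral_finsetSum]
    · simp only [Finset.mul_sum, mul_left_comm]
    · exact fun i _ => integrable_mul_of_hasCompactSupport (contDiff_pd hφ i).continuous
        (hasCompactSupport_pd hs i) ((contDiff_pd (hf 0) j).continuous.mul (hCd i j).continuous)
  have h3 (i : Fin n) : ∑ j, ∫ x, pd i φ x * (pd j (f 0) x * C i j x) =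
      -∑ j, ∫ x, f 0 x * pd j (pd i φ) x * C i j x := by
    have h := integral_mul_sum_pd_mul (contDiff_pd hφ i) (hasCompactSupport_pd hs i) (hf 0)
      (fun j => hCd i j) (hC2 i)
    simp only [Finset.mul_sum] at h
    rw [integral_finsetSum, integral_finsetSum] at h
    · simpa only [mul_assoc] using h
    · intro j _
      simp only [mul_left_comm (f 0 _)]
      exact integrable_mul_of_hasCompactSupport (contDiff_pd (contDiff_pd hφ i) j).continuous
        (hasCompactSupport_pd (hasCompactSupport_pd hs i) j)
        ((hf 0).continuous.mul (hCd i j).continuous)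
    · exact fun j _ => integrable_mul_of_hasCompactSupport (contDiff_pd hφ i).continuous
        (hasCompactSupport_pd hs i) ((contDiff_pd (hf 0) j).continuous.mul (hCd i j).continuous)
  -- `h2` moves the derivative in the row direction to `φ`, `h3` the one in the column direction
  rw [h1, Finset.sum_congr rfl fun j _ => h2 j, Finset.sum_neg_distrib, Finset.sum_comm,
    Finset.sum_congr rfl fun i _ => h3 i, Finset.sum_neg_distrib, neg_neg]

/-! ### Mass bounds and weak convergence -/

/-- The mixed minor of the Hessians of smooth convex functions that belongs to `U` and `W`. -/
def density {n p : ℕ} (U W : AltForm n p) (F : Fin p → SmoothConvex n) : V n → ℝ :=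
  mixedDensity U W fun i => (F i).1

/-- Locally uniform convergence of tuples of smooth convex functions along a filter. -/
def ApproximatesAlong {ι : Type*} (l : Filter ι) {n p : ℕ} (F : ι → Fin p → SmoothConvex n)
    (f : Fin p → V n → ℝ) : Prop :=
  ∀ i, ∀ C : Set (V n), IsCompact C → TendstoUniformlyOn (fun k => (F k i).1) (f i) l C

theorem ApproximatesAlong.tail {ι : Type*} {l : Filter ι} {n p : ℕ}
    {F : ι → Fin (p + 1) → SmoothConvex n} {f : Fin (p + 1) → V n → ℝ}
    (h : ApproximatesAlong l F f) :
    ApproximatesAlong l (fun k i => F k i.succ) fun i => f i.succ :=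
  fun i => h i.succ

theorem continuous_density {n p : ℕ} (U W : AltForm n p) (F : Fin p → SmoothConvex n) :
    Continuous (density U W F) :=
  (contDiff_mixedDensity U W fun i => (F i).2.1).continuous

theorem density_self_nonneg {n p : ℕ} (U : AltForm n p) (F : Fin p → SmoothConvex n) (x : V n) :
    0 ≤ density U U F x :=
  mixed_self_nonneg U fun i => posSemidef_hess (F i).2.1 (F i).2.2 x

theorem abs_density_le {n p : ℕ} (U W : AltForm n p) (F : Fin p → SmoothConvex n) (x : V n) :
    |density U W F x| ≤ (density U U F x + density W W F x) / 2 :=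
  abs_mixed_le U W fun i => posSemidef_hess (F i).2.1 (F i).2.2 x

theorem density_of_isEmpty {n : ℕ} (U W : AltForm n 0) (F G : Fin 0 → SmoothConvex n) :
    density U W F = density U W G := by
  rw [Subsingleton.elim F G]

theorem integral_mul_density {n p : ℕ} (U W : AltForm n (p + 1))
    (F : Fin (p + 1) → SmoothConvex n) {φ : V n → ℝ}
    (hφ : ContDiff ℝ ∞ φ) (hs : HasCompactSupport φ) :
    ∫ x, φ x * density U W F x = ∑ i, ∑ j, ∫ x, (F 0).1 x * pd j (pd i φ) x *
      density (U.contract i) (W.contract j) (fun k => F k.succ) x :=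
  integral_mul_mixedDensity U W (fun i => (F i).2.1) hφ hs

theorem abs_integral_mul_le {n : ℕ} {ψ g : V n → ℝ} {C : Set (V n)} {A : ℝ} (hC : IsCompact C)
    (hψC : ∀ x ∉ C, ψ x = 0) (hA : ∀ x ∈ C, |ψ x| ≤ A) (hg : Continuous g) :
    |∫ x, ψ x * g x| ≤ A * ∫ x in C, |g x| := by
  rw [← setIntegral_eq_integral_of_forall_compl_eq_zero (s := C) fun x hx => by
    rw [hψC x hx, zero_mul], ← integral_const_mul, ← Real.norm_eq_abs]
  refine norm_integral_le_of_norm_le ?_ ?_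
  · exact (continuous_const.mul hg.abs).continuousOn.integrableOn_compact hC
  · refine (ae_restrict_iff' hC.measurableSet).2 (Eventually.of_forall fun x hx => ?_)
    rw [Real.norm_eq_abs, abs_mul]
    exact mul_le_mul_of_nonneg_right (hA x hx) (abs_nonneg _)

theorem exists_abs_le_of_hasCompactSupport {n : ℕ} {ψ : V n → ℝ} (h : Continuous ψ)
    (hs : HasCompactSupport ψ) : ∃ A, 0 ≤ A ∧ ∀ x, |ψ x| ≤ A := by
  obtain ⟨A, hA⟩ := h.bounded_above_of_compact_support hs
  exact ⟨A, (norm_nonneg _).trans (hA 0), hA⟩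

/-- The mixed Hessian measures of a locally uniformly convergent family of convex functions have
locally bounded mass. -/
theorem exists_eventually_integral_abs_density_le {ι : Type*} {l : Filter ι} {n p : ℕ}
    (U W : AltForm n p) {F : ι → Fin p → SmoothConvex n} {f : Fin p → V n → ℝ}
    (hf : ∀ i, Continuous (f i)) (hF : ApproximatesAlong l F f) {C : Set (V n)}
    (hC : IsCompact C) :
    ∃ B, 0 ≤ B ∧ ∀ᶠ k in l, ∫ x in C, |density U W (F k) x| ≤ B := by
  induction p generalizing C with
  | zero =>
    refine ⟨∫ x in C, |density U W Fin.elim0 x|, integral_nonneg fun _ => abs_nonneg _,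
      Eventually.of_forall fun k => ?_⟩
    rw [density_of_isEmpty U W (F k) Fin.elim0]
  | succ p ih =>
    -- for `W = U` the density is nonnegative, so its integral over `C` is at most its integral
    -- against a cutoff function `χ`, in which the derivatives of `F k 0` can be moved to `χ`
    have key (U : AltForm n (p + 1)) :
        ∃ B, 0 ≤ B ∧ ∀ᶠ k in l, ∫ x in C, density U U (F k) x ≤ B := by
      obtain ⟨R, hR0, hR⟩ : ∃ R, 0 < R ∧ C ⊆ Metric.closedBall (0 : V n) R := by
        obtain ⟨R, hR⟩ := hC.isBounded.subset_closedBall 0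
        exact ⟨max R 1, by positivity, hR.trans
          (Metric.closedBall_subset_closedBall (le_max_left _ _))⟩
      let χ : ContDiffBump (0 : V n) := ⟨R, R + 1, hR0, by linarith⟩
      have hχ : ContDiff ℝ ∞ χ := χ.contDiff
      have hχs : HasCompactSupport χ := χ.hasCompactSupport
      have hK : IsCompact (tsupport χ) := hχs
      have hχ0 (i j : Fin n) (x : V n) (hx : x ∉ tsupport χ) : pd j (pd i χ) x = 0 :=
        image_eq_zero_of_notMem_tsupport fun h =>
          hx (tsupport_pd_subset i _ (tsupport_pd_subset j _ h))
      choose A hA0 hA using fun i j => exists_abs_le_of_hasCompactSupport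
        (contDiff_pd (contDiff_pd hχ i) j).continuous
        (hasCompactSupport_pd (hasCompactSupport_pd hχs i) j)
      choose B hB0 hB using fun i j => ih (U.contract i) (U.contract j) (fun i => hf i.succ)
        hF.tail hK
      obtain ⟨D, hD⟩ := hK.exists_bound_of_continuousOn (hf 0).continuousOn
      have hD0 : 0 ≤ |D| + 1 := by positivity
      refine ⟨∑ i, ∑ j, (|D| + 1) * A i j * B i j, Finset.sum_nonneg fun i _ =>
        Finset.sum_nonneg fun j _ => mul_nonneg (mul_nonneg hD0 (hA0 i j)) (hB0 i j), ?_⟩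
      have hFk : ∀ᶠ k in l, ∀ x ∈ tsupport χ, |(F k 0).1 x| ≤ |D| + 1 := by
        filter_upwards [Metric.tendstoUniformlyOn_iff.1 (hF 0 _ hK) 1 one_pos] with k hk x hx
        have h1 := hk x hx
        have h2 := hD x hx
        rw [Real.dist_eq] at h1
        rw [Real.norm_eq_abs] at h2
        have h3 := abs_sub_abs_le_abs_sub ((F k 0).1 x) (f 0 x)
        rw [abs_sub_comm] at h3
        linarith [le_abs_self D]
      filter_upwards [hFk, eventually_all.2 fun i => eventually_all.2 fun j => hB i j]
        with k hk hkB
      calc ∫ x in C, density U U (F k) x = ∫ x in C, χ x * density U U (F k) x := by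
            refine setIntegral_congr_fun hC.measurableSet fun x hx => ?_
            simp only [χ.one_of_mem_closedBall (hR hx), one_mul]
        _ ≤ ∫ x, χ x * density U U (F k) x :=
            setIntegral_le_integral (integrable_mul_of_hasCompactSupport hχ.continuous hχs
              (continuous_density _ _ _)) (Eventually.of_forall fun x =>
                mul_nonneg χ.nonneg (density_self_nonneg _ _ _))
        _ = ∑ i, ∑ j, ∫ x, (F k 0).1 x * pd j (pd i χ) x *
            density (U.contract i) (U.contract j) (fun i => F k i.succ) x :=
            integral_mul_density U U (F k) hχ hχs
        _ ≤ _ := by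
            refine Finset.sum_le_sum fun i _ => Finset.sum_le_sum fun j _ => ?_
            refine (le_abs_self _).trans ((abs_integral_mul_le (A := (|D| + 1) * A i j) hK
              (fun x hx => by rw [hχ0 i j x hx, mul_zero]) (fun x hx => ?_)
              (continuous_density _ _ _)).trans ?_)
            · rw [abs_mul]
              exact mul_le_mul (hk x hx) (hA i j x) (abs_nonneg _) hD0
            · exact mul_le_mul_of_nonneg_left (hkB i j) (mul_nonneg hD0 (hA0 i j))
    obtain ⟨B₁, h₁, hB₁⟩ := key U
    obtain ⟨B₂, h₂, hB₂⟩ := key W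
    refine ⟨(B₁ + B₂) / 2, by positivity, ?_⟩
    filter_upwards [hB₁, hB₂] with k hk₁ hk₂
    have hi (U W : AltForm n (p + 1)) : IntegrableOn (density U W (F k)) C :=
      (continuous_density _ _ _).continuousOn.integrableOn_compact hC
    calc ∫ x in C, |density U W (F k) x|
        ≤ ∫ x in C, (density U U (F k) x + density W W (F k) x) / 2 :=
          integral_mono (hi U W).abs (((hi U U).add (hi W W)).div_const 2)
            fun x => abs_density_le _ _ _ _
      _ = ((∫ x in C, density U U (F k) x) + ∫ x in C, density W W (F k) x) / 2 := by
          rw [integral_div, integral_add (hi U U) (hi W W)]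
      _ ≤ _ := by linarith

/-- Weak convergence of the mixed Hessian measures, tested on continuous functions of compact
support. -/
theorem exists_tendsto_integral_mul_density {ι : Type*} {l : Filter ι} [l.NeBot] {n p : ℕ}
    (U W : AltForm n p) {F : ι → Fin p → SmoothConvex n} {f : Fin p → V n → ℝ}
    (hf : ∀ i, Continuous (f i)) (hF : ApproximatesAlong l F f) {φ : V n → ℝ}
    (hφ : Continuous φ) (hφs : HasCompactSupport φ) :
    ∃ t, Tendsto (fun k => ∫ x, φ x * density U W (F k) x) l (𝓝 t) := by
  induction p generalizing φ with
  | zero =>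
    refine ⟨∫ x, φ x * density U W Fin.elim0 x, ?_⟩
    simp only [density_of_isEmpty U W (F _) Fin.elim0]
    exact tendsto_const_nhds
  | succ p ih =>
    have smooth {φ : V n → ℝ} (hφ : ContDiff ℝ ∞ φ) (hφs : HasCompactSupport φ) :
        ∃ t, Tendsto (fun k => ∫ x, φ x * density U W (F k) x) l (𝓝 t) := by
      have hij (i j : Fin n) : ∃ t, Tendsto (fun k => ∫ x, (F k 0).1 x * pd j (pd i φ) x *
          density (U.contract i) (W.contract j) (fun i => F k i.succ) x) l (𝓝 t) := by
        have hc : Continuous (pd j (pd i φ)) := (contDiff_pd (contDiff_pd hφ i) j).continuous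
        have hs : HasCompactSupport (pd j (pd i φ)) :=
          hasCompactSupport_pd (hasCompactSupport_pd hφs i) j
        obtain ⟨t, ht⟩ := ih (U.contract i) (W.contract j) (fun i => hf i.succ) hF.tail
          ((hf 0).mul hc) hs.mul_left
        obtain ⟨A, hA0, hA⟩ := exists_abs_le_of_hasCompactSupport hc hs
        obtain ⟨B, hB0, hB⟩ := exists_eventually_integral_abs_density_le (U.contract i)
          (W.contract j) (fun i => hf i.succ) hF.tail hs
        refine ⟨t, ?_⟩
        -- replacing `F k 0` by its limit costs at most its uniform distance times the mass bound
        have hdiff : Tendsto (fun k => ∫ x, ((F k 0).1 x - f 0 x) * pd j (pd i φ) x *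
            density (U.contract i) (W.contract j) (fun i => F k i.succ) x) l (𝓝 0) := by
          rw [Metric.tendsto_nhds]
          intro ε hε
          have hδ : 0 < ε / (A * B + 1) := by positivity
          filter_upwards [Metric.tendstoUniformlyOn_iff.1 (hF 0 _ hs) _ hδ, hB] with k hk hkB
          rw [Real.dist_eq, sub_zero]
          refine (abs_integral_mul_le (A := ε / (A * B + 1) * A) hs
            (fun x hx => by rw [image_eq_zero_of_notMem_tsupport hx, mul_zero]) (fun x hx => ?_)
            (continuous_density _ _ _)).trans_lt ?_
          · rw [abs_mul, abs_sub_comm]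
            exact mul_le_mul (hk x hx).le (hA x) (abs_nonneg _) hδ.le
          · refine (mul_le_mul_of_nonneg_left hkB (by positivity)).trans_lt ?_
            rw [div_mul_eq_mul_div, div_mul_eq_mul_div, div_lt_iff₀ (by positivity)]
            nlinarith
        have hsum := hdiff.add ht
        rw [zero_add] at hsum
        refine hsum.congr fun k => ?_
        rw [← integral_add]
        · exact integral_congr_ae (Eventually.of_forall fun x => by
            simp only [Pi.mul_apply]
            ring)
        · exact integrable_mul_of_hasCompactSupport
            ((((F k 0).2.1.continuous.sub (hf 0))).mul hc) hs.mul_left (continuous_density _ _ _)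
        · exact integrable_mul_of_hasCompactSupport ((hf 0).mul hc) hs.mul_left
            (continuous_density _ _ _)
      choose t ht using hij
      refine ⟨∑ i, ∑ j, t i j, ?_⟩
      simp only [integral_mul_density U W _ hφ hφs]
      exact tendsto_finsetSum _ fun i _ => tendsto_finsetSum _ fun j _ => ht i j
    -- by the mass bound, the general case follows by uniform approximation
    refine cauchy_map_iff_exists_tendsto.1 (Metric.cauchy_iff.2 ⟨inferInstance, fun ε hε => ?_⟩)
    obtain ⟨B, hB0, hB⟩ := exists_eventually_integral_abs_density_le U W hf hF hφs
    have hδ : 0 < ε / (4 * (B + 1)) := by positivity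
    obtain ⟨ψ, hψ, hψφ, hsupp⟩ := hφ.exists_contDiff_approx ⊤ (ε := fun _ => ε / (4 * (B + 1)))
      continuous_const fun _ => hδ
    have hψs : HasCompactSupport ψ := hφs.mono hsupp
    obtain ⟨t, ht⟩ := smooth hψ hψs
    have hnear : ∀ᶠ k in l, |(∫ x, φ x * density U W (F k) x) - t| < ε / 2 := by
      filter_upwards [hB, Metric.tendsto_nhds.1 ht (ε / 4) (by positivity)] with k hk hkt
      rw [Real.dist_eq] at hkt
      have h1 : |(∫ x, φ x * density U W (F k) x) - ∫ x, ψ x * density U W (F k) x| ≤ ε / 4 := by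
        rw [← integral_sub (integrable_mul_of_hasCompactSupport hφ hφs (continuous_density _ _ _))
          (integrable_mul_of_hasCompactSupport hψ.continuous hψs (continuous_density _ _ _))]
        simp only [← sub_mul]
        refine (abs_integral_mul_le (A := ε / (4 * (B + 1))) hφs (fun x hx => ?_) (fun x _ => ?_)
          (continuous_density _ _ _)).trans ?_
        · have h0 := image_eq_zero_of_notMem_tsupport hx
          rw [h0, Function.notMem_support.1 fun h => hsupp h h0, sub_zero]
        · rw [abs_sub_comm]
          exact (hψφ x).le
        · refine (mul_le_mul_of_nonneg_left hk hδ.le).trans ?_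
          rw [div_mul_eq_mul_div, div_le_iff₀ (by positivity)]
          nlinarith
      calc _ ≤ _ := abs_sub_le _ (∫ x, ψ x * density U W (F k) x) _
        _ < _ := by linarith
    refine ⟨_, image_mem_map hnear, ?_⟩
    rintro _ ⟨k, hk, rfl⟩ _ ⟨m, hm, rfl⟩
    have hk' : |(∫ x, φ x * density U W (F k) x) - t| < ε / 2 := hk
    have hm' : |(∫ x, φ x * density U W (F m) x) - t| < ε / 2 := hm
    rw [Real.dist_eq]
    rw [abs_sub_comm] at hm'
    calc _ ≤ _ := abs_sub_le _ t _
      _ < _ := by linarith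

/-! ### Smooth convex approximations -/

/-- Mollification of a convex function gives smooth convex functions that converge to it locally
uniformly. -/
theorem exists_smoothConvex_approx {n : ℕ} {f : V n → ℝ} (hf : ConvexOn ℝ Set.univ f) :
    ∃ g : ℕ → SmoothConvex n, ∀ C : Set (V n), IsCompact C →
      TendstoUniformlyOn (fun k => (g k).1) f atTop C := by
  have hc : Continuous f := hf.locallyLipschitz.continuous
  let φ (k : ℕ) : ContDiffBump (0 : V n) :=
    ⟨1 / (k + 1 : ℝ) / 2, 1 / (k + 1 : ℝ), by positivity, half_lt_self (by positivity)⟩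
  let g (k : ℕ) : V n → ℝ :=
    convolution ((φ k).normed volume) f (ContinuousLinearMap.lsmul ℝ ℝ) volume
  have hg (k : ℕ) (x : V n) : g k x = ∫ t, (φ k).normed volume t * f (x - t) := rfl
  have hi (k : ℕ) (x : V n) : Integrable fun t => (φ k).normed volume t * f (x - t) :=
    integrable_mul_of_hasCompactSupport (φ k).continuous_normed (φ k).hasCompactSupport_normed
      (hc.comp (continuous_const.sub continuous_id))
  have hsmooth (k : ℕ) : ContDiff ℝ ∞ (g k) :=
    (φ k).hasCompactSupport_normed.contDiff_convolution_left _ (φ k).contDiff_normed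
      hc.locallyIntegrable
  have hconv (k : ℕ) : ConvexOn ℝ Set.univ (g k) := by
    refine ⟨convex_univ, fun x _ y _ a b ha hb hab => ?_⟩
    rw [hg, hg, hg, smul_eq_mul, smul_eq_mul, ← integral_const_mul, ← integral_const_mul,
      ← integral_add ((hi k x).const_mul a) ((hi k y).const_mul b)]
    refine integral_mono (hi k _) (((hi k x).const_mul a).add ((hi k y).const_mul b)) fun t => ?_
    have h := hf.2 (Set.mem_univ (x - t)) (Set.mem_univ (y - t)) ha hb hab
    have e : a • x + b • y - t = a • (x - t) + b • (y - t) := by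
      rw [smul_sub, smul_sub, sub_add_sub_comm, ← add_smul, hab, one_smul]
    simp only [smul_eq_mul] at h
    rw [e]
    calc _ ≤ (φ k).normed volume t * (a * f (x - t) + b * f (y - t)) :=
          mul_le_mul_of_nonneg_left h ((φ k).nonneg_normed t)
      _ = _ := by ring
  refine ⟨fun k => ⟨g k, hsmooth k, hconv k⟩, fun C hC => ?_⟩
  rw [Metric.tendstoUniformlyOn_iff]
  intro ε hε
  obtain ⟨δ, hδ, h⟩ := Metric.mem_uniformity_dist.1 (hC.uniformContinuousAt_of_continuousAt f
    (fun x _ => hc.continuousAt) (Metric.dist_mem_uniformity (half_pos hε)))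
  filter_upwards [tendsto_one_div_add_atTop_nhds_zero_nat.eventually (gt_mem_nhds hδ)]
    with k hk x hx
  rw [dist_comm]
  refine ((φ k).dist_normed_convolution_le hc.aestronglyMeasurable fun y hy => ?_).trans_lt
    (half_lt_self hε)
  rw [dist_comm]
  refine (h (a := x) (b := y) ?_ hx).le
  rw [dist_comm]
  exact (Metric.mem_ball.1 hy).trans hk

/-! ### The limit currents -/

theorem exists_measure_of_nonneg {n : ℕ} (Λ : C_c(V n, ℝ) →ₗ[ℝ] ℝ) (h : ∀ φ, 0 ≤ φ → 0 ≤ Λ φ) :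
    ∃ μ : Measure (V n), IsLocallyFiniteMeasure μ ∧ ∀ φ : C_c(V n, ℝ), Λ φ = ∫ x, φ x ∂μ := by
  let P : C_c(V n, ℝ) →ₚ[ℝ] ℝ := PositiveLinearMap.mk₀ Λ h
  exact ⟨RealRMK.rieszMeasure P, inferInstance, fun φ => (RealRMK.integral_rieszMeasure P φ).symm⟩

theorem exists_limit_functional {ι : Type*} {l : Filter ι} [l.NeBot] {n p : ℕ}
    (U W : AltForm n p) {F : ι → Fin p → SmoothConvex n} {f : Fin p → V n → ℝ}
    (hf : ∀ i, Continuous (f i)) (hF : ApproximatesAlong l F f) :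
    ∃ Λ : C_c(V n, ℝ) →ₗ[ℝ] ℝ, ∀ φ : C_c(V n, ℝ),
      Tendsto (fun k => ∫ x, φ x * density U W (F k) x) l (𝓝 (Λ φ)) := by
  have h (φ : C_c(V n, ℝ)) :
      ∃ t, Tendsto (fun k => ∫ x, φ x * density U W (F k) x) l (𝓝 t) :=
    exists_tendsto_integral_mul_density U W hf hF φ.continuous φ.hasCompactSupport
  choose Λ hΛ using h
  refine ⟨⟨⟨Λ, fun φ ψ => ?_⟩, fun c φ => ?_⟩, hΛ⟩
  · refine tendsto_nhds_unique (hΛ (φ + ψ)) (((hΛ φ).add (hΛ ψ)).congr fun k => ?_)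
    rw [← integral_add (integrable_mul (continuous_density _ _ _) φ)
      (integrable_mul (continuous_density _ _ _) ψ)]
    simp only [CompactlySupportedContinuousMap.coe_add, Pi.add_apply, add_mul]
  · refine tendsto_nhds_unique (hΛ (c • φ)) (((hΛ φ).const_mul c).congr fun k => ?_)
    rw [← integral_const_mul]
    simp only [CompactlySupportedContinuousMap.coe_smul, Pi.smul_apply, smul_eq_mul, mul_assoc]

/-- The mixed Hessian measures converge to signed measures: `2 |M(U, W)| ≤ M(U, U) + M(W, W)`
exhibits the limit as a difference of two positive functionals. -/
theorem exists_limit_measure {ι : Type*} {l : Filter ι} [l.NeBot] {n p : ℕ}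
    (U W : AltForm n p) {F : ι → Fin p → SmoothConvex n} {f : Fin p → V n → ℝ}
    (hf : ∀ i, Continuous (f i)) (hF : ApproximatesAlong l F f) :
    ∃ μ : SignedRadonMeasure n, ∀ φ : C_c(V n, ℝ),
      Tendsto (fun k => ∫ x, φ x * density U W (F k) x) l (𝓝 (μ.toFun φ)) := by
  obtain ⟨Λ, hΛ⟩ := exists_limit_functional U W hf hF
  obtain ⟨Λ₁, hΛ₁⟩ := exists_limit_functional U U hf hF
  obtain ⟨Λ₂, hΛ₂⟩ := exists_limit_functional W W hf hF
  have hint (U W : AltForm n p) (k : ι) (φ : C_c(V n, ℝ)) :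
      Integrable fun x => φ x * density U W (F k) x :=
    integrable_mul (continuous_density _ _ _) φ
  obtain ⟨μ, hμ, hμΛ⟩ := exists_measure_of_nonneg (Λ + (2⁻¹ : ℝ) • (Λ₁ + Λ₂)) fun φ hφ => by
    refine ge_of_tendsto ((hΛ φ).add (((hΛ₁ φ).add (hΛ₂ φ)).const_mul 2⁻¹))
      (Eventually.of_forall fun k => ?_)
    have e : ∫ x, (φ x * density U W (F k) x +
        2⁻¹ * (φ x * density U U (F k) x + φ x * density W W (F k) x)) =
        (∫ x, φ x * density U W (F k) x) +
          2⁻¹ * ((∫ x, φ x * density U U (F k) x) + ∫ x, φ x * density W W (F k) x) := by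
      rw [← integral_add (hint U U k φ) (hint W W k φ), ← integral_const_mul]
      exact integral_add (hint U W k φ) (((hint U U k φ).add (hint W W k φ)).const_mul _)
    rw [← e]
    refine integral_nonneg fun x => ?_
    have h1 := (abs_le.1 (abs_density_le U W (F k) x)).1
    have h2 : 0 ≤ φ x := hφ x
    have h3 : 0 ≤ φ x * (density U W (F k) x +
      (density U U (F k) x + density W W (F k) x) / 2) := mul_nonneg h2 (by linarith)
    simp only [Pi.zero_apply]
    linarith
  obtain ⟨ν, hν, hνΛ⟩ := exists_measure_of_nonneg ((2⁻¹ : ℝ) • (Λ₁ + Λ₂)) fun φ hφ => by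
    refine ge_of_tendsto (((hΛ₁ φ).add (hΛ₂ φ)).const_mul 2⁻¹)
      (Eventually.of_forall fun k => mul_nonneg (by norm_num) (add_nonneg ?_ ?_))
    all_goals exact integral_nonneg fun x => mul_nonneg (hφ x) (density_self_nonneg _ _ _)
  refine ⟨⟨Λ, μ, ν, hμ, hν, fun φ => ?_⟩, hΛ⟩
  rw [← hμΛ, ← hνΛ, LinearMap.add_apply, add_sub_cancel_right]

/-- Every family of tuples of smooth convex functions that converges locally uniformly has a limit
of its products `dd^# f₁ ∧ … ∧ dd^# f_p`. -/
theorem exists_tendsto_Psi {ι : Type*} {l : Filter ι} [l.NeBot] {n p : ℕ}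
    {F : ι → Fin p → SmoothConvex n} {f : Fin p → V n → ℝ}
    (hf : ∀ i, Continuous (f i)) (hF : ApproximatesAlong l F f) :
    ∃ T : MeasureCurrent n p, Tendsto (fun k => Psi (F k)) l (𝓝 T) := by
  choose U W hUW using exists_coeff_wedgeDDSharp (n := n) (p := p)
  choose μ hμ using fun K L => exists_limit_measure (U K L) (W K L) hf hF
  refine ⟨⟨μ⟩, MeasureCurrent.tendsto_iff.2 fun α => ?_⟩
  refine tendsto_finsetSum _ fun K _ => tendsto_finsetSum _ fun L _ =>
    ((hμ K L (α K.compl L.compl)).const_mul _).congr fun k => ?_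
  congr 1
  change _ = ∫ x, α K.compl L.compl x * coeff K.1 L.1 (wedgeDDSharp (fun i => (F k i).1) x)
  simp only [hUW K L (fun i => (F k i).1) fun i => (F k i).2.1]
  rfl

theorem MultiIndex.compl_injective {n p : ℕ} :
    Function.Injective (MultiIndex.compl : MultiIndex n p → MultiIndex n (n - p)) :=
  fun _ _ h => Subtype.ext (_root_.compl_injective (congrArg Subtype.val h))

/-- A current is determined by its values on test forms. -/
theorem MeasureCurrent.pairing_injective (n p : ℕ) :
    Function.Injective (MeasureCurrent.pairing : MeasureCurrent n p → _) := by
  intro S T h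
  ext K L φ
  classical
  let α : TestForm n (n - p) := fun K' L' => if K' = K.compl ∧ L' = L.compl then φ else 0
  have hα (T : MeasureCurrent n p) : T.pairing α =
      pairingSign K.1 L.1 * (T.coeff K L).toFun φ := by
    rw [MeasureCurrent.pairing, Finset.sum_eq_single K, Finset.sum_eq_single L]
    · simp [α]
    · intro L' _ hL'
      have : α K.compl L'.compl = 0 :=
        if_neg fun h => hL' (MultiIndex.compl_injective h.2)
      rw [this, map_zero, mul_zero]
    · simp
    · intro K' _ hK'
      refine Finset.sum_eq_zero fun L' _ => ?_
      have : α K'.compl L'.compl = 0 :=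
        if_neg fun h => hK' (MultiIndex.compl_injective h.1)
      rw [this, map_zero, mul_zero]
    · simp
  have := congrFun h α
  rw [hα, hα] at this
  exact mul_left_cancel₀ (pairingSign_ne_zero _ _) this

instance (n p : ℕ) : T2Space (MeasureCurrent n p) :=
  T2Space.of_injective_continuous (MeasureCurrent.pairing_injective n p) continuous_induced_dom

/-- Two approximating sequences form a single family indexed by `ℕ ⊕ ℕ`, whose limit is the limit
of both. -/
theorem limit_unique {n p : ℕ} {f : Fin p → V n → ℝ} (hf : ∀ i, Continuous (f i))
    {F G : ℕ → Fin p → SmoothConvex n} (hF : Approximates F f) (hG : Approximates G f)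
    {S T : MeasureCurrent n p} (hS : Tendsto (fun k => Psi (F k)) atTop (𝓝 S))
    (hT : Tendsto (fun k => Psi (G k)) atTop (𝓝 T)) : S = T := by
  obtain ⟨l, hl_def⟩ : ∃ l : Filter (ℕ ⊕ ℕ), l = map Sum.inl atTop ⊔ map Sum.inr atTop :=
    ⟨_, rfl⟩
  have h1 : Tendsto Sum.inl atTop l := hl_def ▸ tendsto_map.mono_right le_sup_left
  have h2 : Tendsto Sum.inr atTop l := hl_def ▸ tendsto_map.mono_right le_sup_right
  have : l.NeBot := h1.neBot
  have hl : ApproximatesAlong l (Sum.elim F G) f := fun i C hC u hu => by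
    rw [hl_def, eventually_sup]
    exact ⟨hF i C hC u hu, hG i C hC u hu⟩
  obtain ⟨R, hR⟩ := exists_tendsto_Psi hf hl
  have hFR : Tendsto (fun k => Psi (F k)) atTop (𝓝 R) := by
    simpa only [Function.comp_def, Sum.elim_inl] using hR.comp h1
  have hGR : Tendsto (fun k => Psi (G k)) atTop (𝓝 R) := by
    simpa only [Function.comp_def, Sum.elim_inr] using hR.comp h2
  exact (tendsto_nhds_unique hS hFR).trans (tendsto_nhds_unique hT hGR).symm

theorem Approximates.comp {n p : ℕ} {F : ℕ → Fin p → SmoothConvex n} {f : Fin p → V n → ℝ}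
    (hF : Approximates F f) {φ : ℕ → ℕ} (hφ : StrictMono φ) :
    Approximates (fun k => F (φ k)) f :=
  fun i C hC u hu => hφ.tendsto_atTop.eventually (hF i C hC u hu)

end SuperCurrent

end

theorem mainTheorem5 (n p : ℕ) (f : Fin p → SuperCurrent.V n → ℝ)
    (hf : ∀ i, ConvexOn ℝ Set.univ (f i)) :
    (∀ F : ℕ → Fin p → SuperCurrent.SmoothConvex n, SuperCurrent.Approximates F f →
      ∃ (φ : ℕ → ℕ) (T : SuperCurrent.MeasureCurrent n p), StrictMono φ ∧
        Tendsto (fun k => SuperCurrent.Psi (F (φ k))) atTop (𝓝 T)) ∧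
    (∀ F G : ℕ → Fin p → SuperCurrent.SmoothConvex n,
      SuperCurrent.Approximates F f → SuperCurrent.Approximates G f →
      ∀ S T : SuperCurrent.MeasureCurrent n p,
        Tendsto (fun k => SuperCurrent.Psi (F k)) atTop (𝓝 S) →
        Tendsto (fun k => SuperCurrent.Psi (G k)) atTop (𝓝 T) → S = T) ∧
    ∃! T : SuperCurrent.MeasureCurrent n p, SuperCurrent.IsIntersectionProduct f T := by
  have hc (i : Fin p) : Continuous (f i) := (hf i).locallyLipschitz.continuous
  refine ⟨fun F hF => ?_, fun F G hF hG S T hS hT =>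
    SuperCurrent.limit_unique hc hF hG hS hT, ?_⟩
  · obtain ⟨T, hT⟩ := SuperCurrent.exists_tendsto_Psi hc hF
    exact ⟨id, T, strictMono_id, hT⟩
  · choose g hg using fun i => SuperCurrent.exists_smoothConvex_approx (hf i)
    have hF : SuperCurrent.Approximates (fun k i => g i k) f := hg
    obtain ⟨T, hT⟩ := SuperCurrent.exists_tendsto_Psi hc hF
    refine ⟨T, ⟨_, hF, id, strictMono_id, hT⟩, ?_⟩
    rintro S ⟨G, hG, φ, hφ, hS⟩
    exact SuperCurrent.limit_unique hc (hG.comp hφ) hF hS hT
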